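/- **Setting.** Let $0<\alpha\le 1$, $R>0$, $h>0$, $a>0$, $\delta_0>0$, and let $B_r$ be the open ball of $\mathbb{R}^2$ with centre $0$ and radius $r$. For an open set $U\subset\mathbb{R}^2$, $C^{1,\alpha}(U)$ consists of the $C^1$ functions on $U$ with finite norm $\|g\|_{C^{1,\alpha}(U)}=\sup_U|g|+\sup_U|Dg|+\sup_{x\ne y\in U}|Dg(x)-Dg(y)|/|x-y|^\alpha$. Let $K:\mathbb{R}^2\to\mathbb{C}$ be of class $C^{1,\alpha}$ on every ball, with $K(x)\to0$ as $|x|\to\infty$. Let $J(x)=(2\pi)^{-2}\int_{\mathbb{R}^2}\hat J(k)e^{\mathrm{i}k\cdot x}\,dk$ with $\hat J\in L^1(\mathbb{R}^2)$ and $\hat J\ge0$ a.e. Let $$A=\{u\in L^1(\mathbb{R}^2):\ 0\le u\le1\text{ a.e.},\ u=0\text{ a.e. outside }B_R\},$$ and for $u\in A$ let $\mathcal{I}(u):\mathbb{R}^2\to\mathbb{R}$ be $$\mathcal{I}(u)(x)=\int_{\mathbb{R}^2}\int_{\mathbb{R}^2}u(\xi)K(x-\xi)J(\xi-\zeta)\overline{K(x-\zeta)}u(\zeta)\,d\xi\,d\zeta,$$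 which is real valued. Let $f:\mathbb{R}\to[0,+\infty]$ be continuous and nonincreasing, with $f=+\infty$ on $(-\infty,0]$, $f=0$ on $[\delta_0,+\infty)$ and $\liminf_{s\to0^+}f(s)s^{2/\alpha}>0$. Let $\psi:\mathbb{R}\to\mathbb{R}$ be $C^1$, nondecreasing on $(-\infty,h]$ and nonincreasing on $[h,+\infty)$, with $\psi(h)>0$ and $\psi(0)<-\delta_0$. Fix $\delta,c_1>0$ with $\psi\ge c_1$ on $[h-\delta,h+\delta]$ and $\psi(0)\le-(\delta_0+\delta)$ (such numbers exist). For $u\in A$ let $$\mathcal{R}(u)=\int_{\mathbb{R}^2}f\big(|\nabla\mathcal{I}(u)|^2-\psi(\mathcal{I}(u))\big)\,dx\in[0,+\infty].$$ Let $\phi:\mathbb{R}\to\mathbb{R}$ be $C^\infty$ and nondecreasing, with $\phi=0$ on $(-\infty,-1/2]$ and $\phi=1$ on $[1/2,+\infty)$. For $\eta>0$ and $u\in A$ let $$\Phi_\eta(u)=\phi\Big(\frac{\mathcal{I}(u)-h}{\eta}\Big),\qquad \mathcal{W}(u)=\chi_{\{\mathcal{I}(u)>h\}}.$$ For an open set $\mathcal{D}$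 let $d_{st}(v,w)=\int_{\mathcal{D}}|v-w|+a\,\big||Dv|(\mathcal{D})-|Dw|(\mathcal{D})\big|$ be the strict-convergence distance on $BV(\mathcal{D})$. **Proposition.** There exists $R_1\ge R$ such that $$\{\mathcal{I}(u)>t\}\subset B_{R_1}\quad\text{for all }u\in A\text{ with }\mathcal{R}(u)<+\infty\text{ and all }t\in[h-\delta,h+\delta].\tag{$*$}$$ For every $R_1\ge R$ satisfying $(*)$, with $\tilde R=R_1+1$, the following hold. 1. For every $\eta>0$ and $u\in A$, $\Phi_\eta(u)$ is of class $C^{1,\alpha}$ on every ball, and it belongs to $C^{1,\alpha}(\mathbb{R}^2)$ if $K\in C^{1,\alpha}(\mathbb{R}^2)$. For every $\eta>0$, $\Phi_\eta$ is uniformly continuous with respect to the $L^1$ norm on $A$ and the norm of $C^{1,\alpha}(B_{\tilde R})$: for every $\varepsilon>0$ there is $\rho>0$ such that $\|\Phi_\eta(u)-\Phi_\eta(v)\|_{C^{1,\alpha}(B_{\tilde R})}\le\varepsilon$ for all $u,v\in A$ with $\|u-v\|_{L^1}\le\rho$. 2. Let $C>0$ and $\tilde A_C=\{u\in A:\mathcal{R}(u)\le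 C\}$. For $u\in\tilde A_C$ and $\eta>0$, $\mathcal{W}(u)$ and $\Phi_\eta(u)$ belong to $BV(B_{\tilde R})$. For every $\varepsilon>0$ there is $\eta_0>0$ such that, for every $0<\eta\le\eta_0$, $$d_{st}(\Phi_\eta(u),\mathcal{W}(u))\le\varepsilon\quad\text{for all }u\in\tilde A_C,$$ where $d_{st}$ is taken on $BV(B_{\tilde R})$. -/

import Mathlib

open MeasureTheory Set Filter Topology
open scoped NNReal ENNReal ContDiff

namespace Photolith

/-- The Euclidean plane. -/
abbrev Plane : Type := EuclideanSpace ℝ (Fin 2)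

/-! ### Hölder spaces -/

/-- The `C^{1,α}` norm on an open set `s`:
`sup_s |f| + sup_s |Df| + sup_{x ≠ y in s} |Df(x) - Df(y)| / |x - y|^α`, with values in `[0, ∞]`. -/
noncomputable def c1aNorm {F : Type*} [NormedAddCommGroup F] [NormedSpace ℝ F]
    (α : ℝ≥0) (s : Set Plane) (f : Plane → F) : ℝ≥0∞ :=
  (⨆ x ∈ s, ‖f x‖ₑ) + (⨆ x ∈ s, ‖fderiv ℝ f x‖ₑ) + eHolderNorm α (s.domRestrict (fderiv ℝ f))

/-- `f ∈ C^{1,α}(s)` for an open set `s`: `f` is `C¹` on `s` with finite `C^{1,α}` norm on `s`. -/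
def IsC1a {F : Type*} [NormedAddCommGroup F] [NormedSpace ℝ F]
    (α : ℝ≥0) (s : Set Plane) (f : Plane → F) : Prop :=
  ContDiffOn ℝ 1 f s ∧ c1aNorm α s f < ⊤

/-- `f` belongs to `C^{1,α}(B)` for every ball `B` of the plane. -/
def IsC1aLoc {F : Type*} [NormedAddCommGroup F] [NormedSpace ℝ F]
    (α : ℝ≥0) (f : Plane → F) : Prop :=
  ∀ r : ℝ, IsC1a α (Metric.ball (0 : Plane) r) f

/-! ### Functions of bounded variation -/

/-- The divergence of a vector field of the plane. -/
noncomputable def divergence (X : Plane → Plane) (x : Plane) : ℝ :=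
  ∑ i : Fin 2, fderiv ℝ X x (EuclideanSpace.single i 1) i

/-- The total variation `|Df|(D)` of the distributional derivative of `f` in the open set `D`:
the supremum of `∫_D f div X` over the fields `X ∈ C¹_c(D; ℝ²)` with `|X| ≤ 1`. -/
noncomputable def totalVar (D : Set Plane) (f : Plane → ℝ) : ℝ≥0∞ :=
  ⨆ (X : Plane → Plane) (_ : ContDiff ℝ 1 X) (_ : HasCompactSupport X) (_ : tsupport X ⊆ D)
    (_ : ∀ x, ‖X x‖ ≤ 1), ENNReal.ofReal (∫ x in D, f x * divergence X x)

/-- `f ∈ BV(D)`. -/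
def IsBV (D : Set Plane) (f : Plane → ℝ) : Prop :=
  IntegrableOn f D ∧ totalVar D f < ⊤

/-- The distance `∫_D |f - g| + a | |Df|(D) - |Dg|(D) |` of strict convergence on `BV(D)`. -/
noncomputable def strictDist (a : ℝ) (D : Set Plane) (f g : Plane → ℝ) : ℝ :=
  (∫ x in D, |f x - g x|) + a * |(totalVar D f).toReal - (totalVar D g).toReal|

/-! ### The optical model -/

/-- The mutual intensity function `J` with Fourier transform `Jhat`:
`J(x) = (2π)⁻² ∫ Jhat(k) e^{i k·x} dk`. -/
noncomputable def mutualIntensity (Jhat : Plane → ℝ) (x : Plane) : ℂ :=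
  (1 / (2 * Real.pi) ^ 2 : ℝ) * ∫ k, (Jhat k : ℂ) * Complex.exp (Complex.I * (inner ℝ k x : ℝ))

/-- The admissible masks: `u ∈ L¹(ℝ²)` with `0 ≤ u ≤ 1` a.e. and `u = 0` a.e. outside `B_R`. -/
def masks (R : ℝ) : Set (Plane →₁[volume] ℝ) :=
  {u | (∀ᵐ x, 0 ≤ u x ∧ u x ≤ 1) ∧ ∀ᵐ x, x ∉ Metric.ball (0 : Plane) R → u x = 0}

/-- The Hopkins double integral
`∫∫ u(ξ) K(x - ξ) J(ξ - ζ) conj(K(x - ζ)) u(ζ) dξ dζ` for the point spread function `K`. -/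
noncomputable def hopkins (K : Plane → ℂ) (Jhat : Plane → ℝ) (u : Plane → ℝ) (x : Plane) : ℂ :=
  ∫ p : Plane × Plane, (u p.1 : ℂ) * K (x - p.1) * mutualIntensity Jhat (p.1 - p.2) *
    (starRingEnd ℂ) (K (x - p.2)) * (u p.2 : ℂ)

theorem conj_mutualIntensity (Jhat : Plane → ℝ) (x : Plane) :
    (starRingEnd ℂ) (mutualIntensity Jhat x) = mutualIntensity Jhat (-x) := by
  unfold mutualIntensity
  rw [map_mul, Complex.conj_ofReal, ← integral_conj]
  congr 2
  ext k
  rw [map_mul, Complex.conj_ofReal, ← Complex.exp_conj, map_mul, Complex.conj_I,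
    Complex.conj_ofReal, inner_neg_right]
  push_cast
  ring_nf

/-- The Hopkins integral is a real number. -/
theorem hopkins_im (K : Plane → ℂ) (Jhat : Plane → ℝ) (u : Plane → ℝ) (x : Plane) :
    (hopkins K Jhat u x).im = 0 := by
  rw [← Complex.conj_eq_iff_im]
  unfold hopkins
  rw [← integral_conj, Measure.volume_eq_prod]
  rw [← integral_prod_swap]
  congr 1
  ext p
  simp only [map_mul, Complex.conj_ofReal, conj_mutualIntensity, Complex.conj_conj,
    Prod.fst_swap, Prod.snd_swap, neg_sub]
  ring

/-- The light intensity `𝓘(u)`, the Hopkins integral as a real valued function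
(its imaginary part vanishes by `hopkins_im`). -/
noncomputable def intensity (K : Plane → ℂ) (Jhat : Plane → ℝ) (u : Plane → ℝ) (x : Plane) : ℝ :=
  (hopkins K Jhat u x).re

/-- The exposed region `{𝓘(u) > t}` at level `t`. -/
def exposed (K : Plane → ℂ) (Jhat : Plane → ℝ) (t : ℝ) (u : Plane → ℝ) : Set Plane :=
  {x | t < intensity K Jhat u x}

/-- The sharp threshold map `𝓦(u)`, the characteristic function of `{𝓘(u) > h}`. -/
noncomputable def sharpMap (K : Plane → ℂ) (Jhat : Plane → ℝ) (h : ℝ) (u : Plane → ℝ) :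
    Plane → ℝ :=
  (exposed K Jhat h u).indicator 1

/-- The smoothed threshold map `Φ_η(u) = φ((𝓘(u) - h) / η)`. -/
noncomputable def smoothMap (K : Plane → ℂ) (Jhat : Plane → ℝ) (h : ℝ) (φ : ℝ → ℝ) (η : ℝ)
    (u : Plane → ℝ) : Plane → ℝ :=
  fun x => φ ((intensity K Jhat u x - h) / η)

/-- The regularization term `𝓡(u) = ∫ f(|∇𝓘(u)|² - ψ(𝓘(u)))`, with values in `[0, ∞]`. -/
noncomputable def regTerm (K : Plane → ℂ) (Jhat : Plane → ℝ) (f : ℝ → ℝ≥0∞) (ψ : ℝ → ℝ)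
    (u : Plane → ℝ) : ℝ≥0∞ :=
  ∫⁻ x, f (‖gradient (intensity K Jhat u) x‖ ^ 2 - ψ (intensity K Jhat u x))

end Photolith

open Photolith

/-! The intensity integrates the kernel `K (x - ξ) * conj (K (x - ζ))` against the weight `u(ξ) J(ξ
- ζ) u(ζ)`, which lives on a fixed compact set and, `J` being bounded, depends on the mask in a
Lipschitz way for the `L¹` norms. So `𝓘(u)` inherits from `K` its `C^{1,α}` bounds, uniformly in
`u`, and is Lipschitz in `u` (`exists_C1aBound_intensity_sub`). Composition with a fixed smooth
profile preserves both facts, which gives part 1. The decay of `K` makes `𝓘(u)` uniformly small far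
away, so the level sets above `h - δ > 0` are uniformly bounded.

For part 2, a finite `𝓡(u)` forces nondegeneracy (`lt_sq_norm_fderiv`). If `|∇𝓘|² ≤ ψ(𝓘)` at a point
`x₀`, Hölder continuity gives `|∇𝓘|² - ψ(𝓘) ≤ L |x - x₀|^α` nearby, and the growth of `f` at `0`
makes the integrand at least a multiple of `|x - x₀|⁻²`, which is not integrable in the plane. Hence
`|∇𝓘| ≥ √c₁` wherever `|𝓘 - h| ≤ δ`.

Strict convergence then follows by a calibration argument, without the coarea formula. For each `ε`
there is a test field `X` with `-∇𝓘·X ≥ (1 - ε)|∇𝓘|` near the level, whose divergence is bounded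
uniformly in `u` (`exists_alignedField`). The gradient is only Hölder, so `X` is built from
difference quotients. By integration by parts, `X` realizes up to the factor `1 - ε` the total
variation of every increasing function of `𝓘` varying only near `h`. This bounds the total
variations and shows that the band `|𝓘 - h| ≤ η` has area `O(η)` (`exists_volume_levelBand_le`),
which controls the `L¹` distance. Since `∫ Φ_η div X` and `∫ 𝓦 div X` then differ by `O(η)`, the two
total variations are comparable (`exists_totalVar_comparison`); all constants are uniform in `u`. -/

namespace Photolith

/-! ### Quantitative `C^{1,α}` bounds -/

section Holder

variable {F G : Type*} [NormedAddCommGroup F] [NormedSpace ℝ F]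
  [NormedAddCommGroup G] [NormedSpace ℝ G] {α : ℝ≥0} {M m : ℝ} {s t : Set Plane}

/-- `f`, `Df` and the Hölder quotient of `Df` are bounded by `M` on `s`. -/
structure C1aBound (α : ℝ≥0) (M : ℝ) (s : Set Plane) (f : Plane → F) : Prop where
  val : ∀ x ∈ s, ‖f x‖ ≤ M
  der : ∀ x ∈ s, ‖fderiv ℝ f x‖ ≤ M
  hol : ∀ x ∈ s, ∀ y ∈ s, ‖fderiv ℝ f x - fderiv ℝ f y‖ ≤ M * ‖x - y‖ ^ (α : ℝ)

theorem C1aBound.mono {f : Plane → F} (h : C1aBound α M s f) (hM : M ≤ m) (hst : t ⊆ s) :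
    C1aBound α m t f where
  val x hx := (h.val x (hst hx)).trans hM
  der x hx := (h.der x (hst hx)).trans hM
  hol x hx y hy := (h.hol x (hst hx) y (hst hy)).trans (by gcongr)

theorem C1aBound.c1aNorm_le {f : Plane → F} (hM : 0 ≤ M) (h : C1aBound α M s f) :
    c1aNorm α s f ≤ ENNReal.ofReal (3 * M) := by
  have e : ENNReal.ofReal (3 * M) = ENNReal.ofReal M + ENNReal.ofReal M + ENNReal.ofReal M := by
    rw [← ENNReal.ofReal_add hM hM, ← ENNReal.ofReal_add (by positivity) hM]
    congr 1
    ring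
  rw [e]
  unfold c1aNorm
  gcongr
  · refine iSup₂_le fun x hx => ?_
    rw [← ofReal_norm]
    exact ENNReal.ofReal_le_ofReal (h.val x hx)
  · refine iSup₂_le fun x hx => ?_
    rw [← ofReal_norm]
    exact ENNReal.ofReal_le_ofReal (h.der x hx)
  · have : HolderWith M.toNNReal α (s.domRestrict (fderiv ℝ f)) := by
      intro x y
      rw [edist_dist, edist_dist, ENNReal.ofReal_rpow_of_nonneg dist_nonneg (NNReal.coe_nonneg α),
        ← ENNReal.ofReal, ← ENNReal.ofReal_mul hM, dist_eq_norm]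
      apply ENNReal.ofReal_le_ofReal
      rw [Subtype.dist_eq, dist_eq_norm]
      exact h.hol x x.2 y y.2
    exact this.eHolderNorm_le

theorem exists_C1aBound_of_c1aNorm_lt_top {f : Plane → F} (h : c1aNorm α s f < ⊤) :
    ∃ M, 0 ≤ M ∧ C1aBound α M s f := by
  have hn := h.ne
  refine ⟨(c1aNorm α s f).toReal, ENNReal.toReal_nonneg, ?_, ?_, ?_⟩
  · intro x hx
    rw [← toReal_enorm]
    refine ENNReal.toReal_mono hn ?_
    unfold c1aNorm
    rw [add_assoc]
    exact (le_iSup₂ (f := fun x (_ : x ∈ s) => ‖f x‖ₑ) x hx).trans le_self_add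
  · intro x hx
    rw [← toReal_enorm]
    refine ENNReal.toReal_mono hn ?_
    unfold c1aNorm
    exact (le_iSup₂ (f := fun x (_ : x ∈ s) => ‖fderiv ℝ f x‖ₑ) x hx).trans
      (le_add_self.trans le_self_add)
  · intro x hx y hy
    have hle : eHolderNorm α (s.domRestrict (fderiv ℝ f)) ≤ c1aNorm α s f := le_add_self
    have hm : MemHolder α (s.domRestrict (fderiv ℝ f)) :=
      eHolderNorm_ne_top.1 (hle.trans_lt h).ne
    have hw := hm.holderWith
    have h1 := hw.dist_le ⟨x, hx⟩ ⟨y, hy⟩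
    rw [Subtype.dist_eq, dist_eq_norm, dist_eq_norm] at h1
    refine h1.trans ?_
    gcongr
    rw [← ENNReal.coe_toReal, hm.coe_nnHolderNorm_eq_eHolderNorm]
    exact ENNReal.toReal_mono hn hle

theorem IsC1aLoc.contDiff {f : Plane → F} (h : IsC1aLoc α f) : ContDiff ℝ 1 f := by
  rw [contDiff_iff_contDiffAt]
  intro x
  exact (h (‖x‖ + 1)).1.contDiffAt (Metric.isOpen_ball.mem_nhds (by simp))

theorem IsC1aLoc.exists_bound {f : Plane → F} (h : IsC1aLoc α f) (r : ℝ) :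
    ∃ M, 0 ≤ M ∧ C1aBound α M (Metric.ball 0 r) f :=
  exists_C1aBound_of_c1aNorm_lt_top (h r).2

theorem C1aBound.isC1a {f : Plane → F} (hf : ContDiff ℝ 1 f) (hM : 0 ≤ M)
    (h : C1aBound α M s f) : IsC1a α s f :=
  ⟨hf.contDiffOn, (h.c1aNorm_le hM).trans_lt ENNReal.ofReal_lt_top⟩

/-- Hölder continuity from bounds on the function and on its derivative. -/
theorem norm_sub_le_rpow (hα1 : α ≤ 1) (hs : Convex ℝ s) {f : Plane → F}
    (hf : Differentiable ℝ f) (hM : 0 ≤ M) (hv : ∀ x ∈ s, ‖f x‖ ≤ M)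
    (hd : ∀ x ∈ s, ‖fderiv ℝ f x‖ ≤ M) {x y : Plane} (hx : x ∈ s) (hy : y ∈ s) :
    ‖f x - f y‖ ≤ 2 * M * ‖x - y‖ ^ (α : ℝ) := by
  -- At distance at most one the mean value inequality suffices, because `α ≤ 1`; at larger distance
  -- the sup bound does, because the power is at least one.
  rcases le_total ‖x - y‖ 1 with h1 | h1
  · have h2 := hs.norm_image_sub_le_of_norm_fderiv_le (fun z _ => hf z) hd hy hx
    have h3 : ‖x - y‖ ≤ ‖x - y‖ ^ (α : ℝ) :=
      Real.self_le_rpow_of_le_one (norm_nonneg _) h1 (by exact_mod_cast hα1)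
    have h4 := mul_le_mul_of_nonneg_left h3 hM
    have h5 : 0 ≤ M * ‖x - y‖ := by positivity
    nlinarith
  · have h2 := norm_sub_le (f x) (f y)
    have h3 : 1 ≤ ‖x - y‖ ^ (α : ℝ) := Real.one_le_rpow h1 α.2
    have := hv x hx
    have := hv y hy
    nlinarith

theorem C1aBound.norm_sub_le (hα1 : α ≤ 1) (hs : Convex ℝ s) {f : Plane → F}
    (hf : Differentiable ℝ f) (hM : 0 ≤ M) (h : C1aBound α M s f) {x y : Plane} (hx : x ∈ s)
    (hy : y ∈ s) : ‖f x - f y‖ ≤ 2 * M * ‖x - y‖ ^ (α : ℝ) :=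
  norm_sub_le_rpow hα1 hs hf hM h.val h.der hx hy

theorem C1aBound.clm_comp {f : Plane → F} (hf : Differentiable ℝ f) (h : C1aBound α M s f)
    (A : F →L[ℝ] G) (hA : ‖A‖ ≤ 1) : C1aBound α M s (fun x => A (f x)) := by
  have hd : ∀ x, fderiv ℝ (fun x => A (f x)) x = A.comp (fderiv ℝ f x) := fun x =>
    (A.hasFDerivAt.comp x (hf x).hasFDerivAt).fderiv
  refine ⟨fun x hx => ?_, fun x hx => ?_, fun x hx y hy => ?_⟩
  · exact ((A.le_of_opNorm_le hA _).trans_eq (one_mul _)).trans (h.val x hx)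
  · rw [hd]
    refine (A.opNorm_comp_le _).trans ?_
    exact (mul_le_of_le_one_left (norm_nonneg _) hA).trans (h.der x hx)
  · rw [hd, hd, ← ContinuousLinearMap.comp_sub]
    refine (A.opNorm_comp_le _).trans ?_
    exact (mul_le_of_le_one_left (norm_nonneg _) hA).trans (h.hol x hx y hy)

/-- By the Leibniz rule the increment of the derivative splits into four products. Two contain an
increment of a factor (`2M · M` each) and two an increment of a derivative (`M · M` each), whence
the constant 6. -/
theorem C1aBound.mul (hα1 : α ≤ 1) (hs : Convex ℝ s) {f g : Plane → ℂ}
    (hf : Differentiable ℝ f) (hg : Differentiable ℝ g) (hM : 0 ≤ M)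
    (h : C1aBound α M s f) (h' : C1aBound α M s g) :
    C1aBound α (6 * M ^ 2) s (fun x => f x * g x) := by
  have hd : ∀ x, fderiv ℝ (fun x => f x * g x) x = f x • fderiv ℝ g x + g x • fderiv ℝ f x :=
    fun x => fderiv_fun_mul (hf x) (hg x)
  have prod : ∀ {E : Type} [NormedAddCommGroup E] [NormedSpace ℂ E] (c : ℂ) (e : E) {p q : ℝ},
      ‖c‖ ≤ p → ‖e‖ ≤ q → ‖c • e‖ ≤ p * q := fun c e p q hp hq => by
    rw [norm_smul]
    exact mul_le_mul hp hq (norm_nonneg _) ((norm_nonneg _).trans hp)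
  refine ⟨fun x hx => ?_, fun x hx => ?_, fun x hx y hy => ?_⟩
  · have := prod _ _ (h.val x hx) (h'.val x hx)
    rw [smul_eq_mul] at this
    nlinarith
  · rw [hd]
    have h1 := prod _ _ (h.val x hx) (h'.der x hx)
    have h2 := prod _ _ (h'.val x hx) (h.der x hx)
    have h3 := norm_add_le (f x • fderiv ℝ g x) (g x • fderiv ℝ f x)
    nlinarith
  · have e : fderiv ℝ (fun x => f x * g x) x - fderiv ℝ (fun x => f x * g x) y
        = ((f x - f y) • fderiv ℝ g x + f y • (fderiv ℝ g x - fderiv ℝ g y))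
          + ((g x - g y) • fderiv ℝ f x + g y • (fderiv ℝ f x - fderiv ℝ f y)) := by
      rw [hd, hd]
      module
    rw [e]
    have h1 := prod _ _ (h.norm_sub_le hα1 hs hf hM hx hy) (h'.der x hx)
    have h2 := prod _ _ (h'.norm_sub_le hα1 hs hg hM hx hy) (h.der x hx)
    have h3 := prod _ _ (h.val y hy) (h'.hol x hx y hy)
    have h4 := prod _ _ (h'.val y hy) (h.hol x hx y hy)
    refine (norm_add_le_of_le (norm_add_le_of_le h1 h3) (norm_add_le_of_le h2 h4)).trans_eq ?_
    ring

end Holder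

/-! ### Composition with a function of one variable -/

section Composition

variable {α : ℝ≥0} {M m N : ℝ} {s : Set Plane}

theorem fderiv_comp_real {F : ℝ → ℝ} (hF : Differentiable ℝ F) {I : Plane → ℝ}
    (hI : Differentiable ℝ I) (x : Plane) :
    fderiv ℝ (fun x => F (I x)) x = deriv F (I x) • fderiv ℝ I x :=
  ((hF (I x)).hasDerivAt.comp_hasFDerivAt x (hI x).hasFDerivAt).fderiv

/-- By the chain rule the derivative is `F'(I) DI`. The first factor is Hölder because `F'` is
Lipschitz and `I` is Hölder. -/
theorem C1aBound.comp (hα1 : α ≤ 1) (hs : Convex ℝ s) {F : ℝ → ℝ} (hF : Differentiable ℝ F)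
    (hF' : Differentiable ℝ (deriv F)) (hN : 0 ≤ N) (hM : 0 ≤ M) (h0 : ∀ t, |F t| ≤ N)
    (h1 : ∀ t, |deriv F t| ≤ N) (h2 : ∀ t, |deriv (deriv F) t| ≤ N) {I : Plane → ℝ}
    (hI : Differentiable ℝ I) (h : C1aBound α M s I) :
    C1aBound α (N * (1 + 2 * M) * (1 + M)) s (fun x => F (I x)) := by
  refine ⟨fun x hx => ?_, fun x hx => ?_, fun x hx y hy => ?_⟩
  · refine (h0 _).trans ?_
    nlinarith [mul_nonneg hN hM, mul_nonneg (mul_nonneg hN hM) hM]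
  · rw [fderiv_comp_real hF hI, norm_smul]
    have := mul_le_mul (h1 (I x)) (h.der x hx) (norm_nonneg _) hN
    rw [← Real.norm_eq_abs] at this
    nlinarith [mul_nonneg hN hM, mul_nonneg (mul_nonneg hN hM) hM]
  · rw [fderiv_comp_real hF hI, fderiv_comp_real hF hI]
    have hQ : |deriv F (I x) - deriv F (I y)| ≤ N * (2 * M * ‖x - y‖ ^ (α : ℝ)) := by
      have := Convex.norm_image_sub_le_of_norm_deriv_le (f := deriv F) (s := univ)
        (fun t _ => hF' t) (fun t _ => h2 t) convex_univ (mem_univ (I y)) (mem_univ (I x))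
      refine this.trans ?_
      gcongr
      exact h.norm_sub_le hα1 hs hI hM hx hy
    have e : deriv F (I x) • fderiv ℝ I x - deriv F (I y) • fderiv ℝ I y
        = (deriv F (I x) - deriv F (I y)) • fderiv ℝ I x
          + deriv F (I y) • (fderiv ℝ I x - fderiv ℝ I y) := by module
    rw [e]
    refine (norm_add_le _ _).trans ?_
    rw [norm_smul, norm_smul, Real.norm_eq_abs, Real.norm_eq_abs]
    have hr : 0 ≤ ‖x - y‖ ^ (α : ℝ) := by positivity
    have a1 := mul_le_mul hQ (h.der x hx) (norm_nonneg _) (by positivity)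
    have a2 := mul_le_mul (h1 (I y)) (h.hol x hx y hy) (norm_nonneg _) hN
    refine (add_le_add a1 a2).trans ?_
    have p1 : 0 ≤ N * ‖x - y‖ ^ (α : ℝ) := by positivity
    have p2 : 0 ≤ N * ‖x - y‖ ^ (α : ℝ) * M := by positivity
    have p3 : 0 ≤ N * ‖x - y‖ ^ (α : ℝ) * M * M := by positivity
    nlinarith

/-- Lipschitz dependence of `F ∘ I` on `I` in the `C^{1,α}` norm. -/
theorem C1aBound.comp_sub (hα1 : α ≤ 1) (hs : Convex ℝ s) {F : ℝ → ℝ} (hF : Differentiable ℝ F)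
    (hF' : Differentiable ℝ (deriv F)) (hF'' : Differentiable ℝ (deriv (deriv F)))
    (hN : 0 ≤ N) (hM : 0 ≤ M) (hm : 0 ≤ m)
    (h1 : ∀ t, |deriv F t| ≤ N) (h2 : ∀ t, |deriv (deriv F) t| ≤ N)
    (h3 : ∀ t, |deriv (deriv (deriv F)) t| ≤ N) {I J : Plane → ℝ}
    (hI : Differentiable ℝ I) (hJ : Differentiable ℝ J) (h : C1aBound α M s I)
    (h' : C1aBound α M s J) (hd : C1aBound α m s (fun x => I x - J x)) :
    C1aBound α (N * (1 + 3 * M) * (1 + 3 * M) * m) s (fun x => F (I x) - F (J x)) := by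
  have lip : ∀ {H : ℝ → ℝ}, Differentiable ℝ H → (∀ t, |deriv H t| ≤ N) → ∀ x ∈ s,
      |H (I x) - H (J x)| ≤ N * m := fun {H} hH hH' x hx => by
    have := Convex.norm_image_sub_le_of_norm_deriv_le (f := H) (s := univ)
      (fun t _ => hH t) (fun t _ => hH' t) convex_univ (mem_univ (J x)) (mem_univ (I x))
    exact this.trans (mul_le_mul_of_nonneg_left (hd.val x hx) hN)
  have dsub : ∀ x, fderiv ℝ (fun x => I x - J x) x = fderiv ℝ I x - fderiv ℝ J x :=
    fun x => fderiv_fun_sub (hI x) (hJ x)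
  have hdiff : ∀ {H : ℝ → ℝ}, Differentiable ℝ H →
      Differentiable ℝ (fun x => H (I x) - H (J x)) := fun hH => (hH.comp hI).sub (hH.comp hJ)
  -- This splitting leaves in each term a factor that is small with `m`. It is stated for a general
  -- `H` because it serves for both `F` and `F'`.
  have ef : ∀ {H : ℝ → ℝ}, Differentiable ℝ H → ∀ x, fderiv ℝ (fun x => H (I x) - H (J x)) x
      = deriv H (I x) • fderiv ℝ (fun x => I x - J x) x
        + (deriv H (I x) - deriv H (J x)) • fderiv ℝ J x := fun {H} hH x => by
    rw [fderiv_fun_sub (f := fun x => H (I x)) (g := fun x => H (J x)) ((hH.comp hI) x)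
      ((hH.comp hJ) x), fderiv_comp_real hH hI,
      fderiv_comp_real hH hJ, dsub]
    module
  have der : ∀ {H : ℝ → ℝ}, Differentiable ℝ H → Differentiable ℝ (deriv H) →
      (∀ t, |deriv H t| ≤ N) → (∀ t, |deriv (deriv H) t| ≤ N) → ∀ x ∈ s,
      ‖fderiv ℝ (fun x => H (I x) - H (J x)) x‖ ≤ N * m * (1 + M) :=
    fun {H} hH hH' b1 b2 x hx => by
    rw [ef hH]
    refine (norm_add_le _ _).trans ?_
    rw [norm_smul, norm_smul, Real.norm_eq_abs, Real.norm_eq_abs]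
    have a1 := mul_le_mul (b1 (I x)) (hd.der x hx) (norm_nonneg _) hN
    have a2 := mul_le_mul (lip hH' b2 x hx) (h'.der x hx) (norm_nonneg _) (by positivity)
    linarith
  have q1 : 0 ≤ N * m := by positivity
  have q2 : 0 ≤ N * m * M := by positivity
  have q3 : 0 ≤ N * m * M * M := by positivity
  refine ⟨fun x hx => ?_, fun x hx => ?_, fun x hx y hy => ?_⟩
  · refine (lip hF h1 x hx).trans ?_
    nlinarith
  · refine (der hF hF' h1 h2 x hx).trans ?_
    nlinarith
  · have r0 : 0 ≤ ‖x - y‖ ^ (α : ℝ) := by positivity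
    -- The difference `F'(I) - F'(J)` must be Hölder with a constant proportional to `m`. This comes
    -- from its sup bound and from the bound on its derivative, which is where the third derivative
    -- of `F` enters.
    have hQ := norm_sub_le_rpow (M := N * m * (1 + M)) hα1 hs (hdiff hF') (by positivity)
      (fun x hx => (lip hF' h2 x hx).trans (by nlinarith)) (der hF' hF'' h2 h3) hx hy
    have hP : |deriv F (I x) - deriv F (I y)| ≤ N * (2 * M * ‖x - y‖ ^ (α : ℝ)) := by
      have := Convex.norm_image_sub_le_of_norm_deriv_le (f := deriv F) (s := univ)
        (fun t _ => hF' t) (fun t _ => h2 t) convex_univ (mem_univ (I y)) (mem_univ (I x))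
      refine this.trans ?_
      gcongr
      exact h.norm_sub_le hα1 hs hI hM hx hy
    rw [ef hF, ef hF]
    generalize hQx : deriv F (I x) - deriv F (J x) = Qx at *
    generalize hQy : deriv F (I y) - deriv F (J y) = Qy at *
    have b := lip hF' h2 y hy
    rw [hQy] at b
    have e : deriv F (I x) • fderiv ℝ (fun x => I x - J x) x + Qx • fderiv ℝ J x
          - (deriv F (I y) • fderiv ℝ (fun x => I x - J x) y + Qy • fderiv ℝ J y)
        = ((deriv F (I x) - deriv F (I y)) • fderiv ℝ (fun x => I x - J x) x
          + deriv F (I y) • (fderiv ℝ (fun x => I x - J x) x - fderiv ℝ (fun x => I x - J x) y))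
          + ((Qx - Qy) • fderiv ℝ J x + Qy • (fderiv ℝ J x - fderiv ℝ J y)) := by module
    rw [e]
    refine (norm_add_le_of_le (norm_add_le_of_le (norm_smul_le _ _) (norm_smul_le _ _))
      (norm_add_le_of_le (norm_smul_le _ _) (norm_smul_le _ _))).trans ?_
    have a1 := mul_le_mul hP (hd.der x hx) (norm_nonneg _) (by positivity)
    have a2 := mul_le_mul (h1 (I y)) (hd.hol x hx y hy) (norm_nonneg _) hN
    have a3 := mul_le_mul hQ (h'.der x hx) (norm_nonneg _) (by positivity)
    have a4 := mul_le_mul b (h'.hol x hx y hy) (norm_nonneg _) (by positivity)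
    refine (add_le_add (add_le_add a1 a2) (add_le_add a3 a4)).trans ?_
    have p1 : 0 ≤ N * m * ‖x - y‖ ^ (α : ℝ) := by positivity
    have p2 : 0 ≤ N * m * ‖x - y‖ ^ (α : ℝ) * M := by positivity
    have p3 : 0 ≤ N * m * ‖x - y‖ ^ (α : ℝ) * M * M := by positivity
    nlinarith

end Composition

/-! ### Regularity of the intensity -/

section Intensity

variable {α : ℝ≥0} {M : ℝ} {s t : Set Plane}

/-- A positive Hölder exponent makes the derivative continuous. -/
theorem contDiff_of_C1aBound {f : Plane → ℝ} (hα0 : 0 < α) (hf : Differentiable ℝ f)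
    (h : ∀ r : ℝ, ∃ M, 0 ≤ M ∧ C1aBound α M (Metric.ball 0 r) f) : ContDiff ℝ 1 f := by
  rw [contDiff_one_iff_fderiv]
  refine ⟨hf, continuous_iff_continuousAt.2 fun x => ?_⟩
  obtain ⟨M, -, hM⟩ := h (‖x‖ + 1)
  have hx : x ∈ Metric.ball (0 : Plane) (‖x‖ + 1) := by simp
  rw [ContinuousAt, tendsto_iff_norm_sub_tendsto_zero]
  have hlim : Tendsto (fun y : Plane => M * ‖y - x‖ ^ (α : ℝ)) (𝓝 x) (𝓝 0) := by
    have : ContinuousAt (fun y : Plane => M * ‖y - x‖ ^ (α : ℝ)) x := by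
      refine continuousAt_const.mul (ContinuousAt.rpow_const (by fun_prop) (Or.inr ?_))
      exact_mod_cast hα0.le
    convert this.tendsto using 2
    have : (α : ℝ) ≠ 0 := by exact_mod_cast hα0.ne'
    simp [Real.zero_rpow this]
  refine squeeze_zero' (Eventually.of_forall fun _ => norm_nonneg _) ?_ hlim
  filter_upwards [Metric.isOpen_ball.mem_nhds hx] with y hy using hM.hol y hy x hx

theorem norm_mutualIntensity_le (Jhat : Plane → ℝ) (x : Plane) :
    ‖mutualIntensity Jhat x‖ ≤ (1 / (2 * Real.pi) ^ 2) * ∫ k, ‖Jhat k‖ := by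
  unfold mutualIntensity
  rw [norm_mul, Complex.norm_real, Real.norm_of_nonneg (by positivity)]
  gcongr
  refine (norm_integral_le_integral_norm _).trans_eq ?_
  congr 1
  ext k
  rw [norm_mul, Complex.norm_real, Complex.norm_exp_I_mul_ofReal, mul_one]

theorem continuous_mutualIntensity {Jhat : Plane → ℝ} (hJ : Integrable Jhat) :
    Continuous (mutualIntensity Jhat) := by
  unfold mutualIntensity
  refine continuous_const.mul ?_
  refine continuous_of_dominated (bound := fun k => ‖Jhat k‖) (fun x => ?_) (fun x => ?_) hJ.norm ?_
  · refine (Complex.continuous_ofReal.comp_aestronglyMeasurable hJ.aestronglyMeasurable).mul ?_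
    exact Continuous.aestronglyMeasurable (by fun_prop)
  · refine Eventually.of_forall fun k => ?_
    rw [norm_mul, Complex.norm_real, Complex.norm_exp_I_mul_ofReal, mul_one]
  · exact Eventually.of_forall fun k => by fun_prop

/-! ### Integrals of a `C¹` kernel against a compactly supported weight -/

section Weighted

variable {W : Plane × Plane → ℂ} {S : Set (Plane × Plane)} {g : Plane × Plane → Plane → ℂ}

theorem integrable_smul_of_compact {E : Type*} [NormedAddCommGroup E] [NormedSpace ℂ E]
    [SecondCountableTopology E]
    (hW : Integrable W) (hS : IsCompact S) (hWS : ∀ᵐ p, p ∉ S → W p = 0)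
    {k : Plane × Plane → E} (hk : Continuous k) : Integrable (fun p => W p • k p) := by
  obtain ⟨C, hC⟩ := hS.exists_bound_of_continuousOn hk.continuousOn
  refine (hW.norm.mul_const C).mono' (hW.aestronglyMeasurable.smul hk.aestronglyMeasurable) ?_
  filter_upwards [hWS] with p hp
  rw [norm_smul]
  by_cases h : p ∈ S
  · gcongr
    exact hC p h
  · simp [hp h]

theorem norm_integral_smul_le_of_compact {E : Type*} [NormedAddCommGroup E] [NormedSpace ℂ E]
    (hW : Integrable W) (hWS : ∀ᵐ p, p ∉ S → W p = 0) {k : Plane × Plane → E} {C : ℝ}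
    (hk : ∀ p ∈ S, ‖k p‖ ≤ C) : ‖∫ p, W p • k p‖ ≤ C * ∫ p, ‖W p‖ := by
  rw [← integral_const_mul]
  refine norm_integral_le_of_norm_le (hW.norm.const_mul C) ?_
  filter_upwards [hWS] with p hp
  rw [norm_smul, mul_comm]
  by_cases h : p ∈ S
  · gcongr
    exact hk p h
  · simp [hp h]

/-- Differentiation under the integral sign. The dominating function is `‖W‖` times the maximum of
the kernel's derivative over the compact set `S × closedBall x 1`. -/
theorem hasFDerivAt_integral_mul (hW : Integrable W) (hS : IsCompact S)
    (hWS : ∀ᵐ p, p ∉ S → W p = 0) (hg : ContDiff ℝ 1 (Function.uncurry g)) (x : Plane) :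
    HasFDerivAt (fun x => ∫ p, W p * g p x) (∫ p, W p • fderiv ℝ (g p) x) x := by
  have hc : ∀ x, Continuous fun p => g p x := fun x =>
    hg.continuous.comp (by fun_prop : Continuous fun p : Plane × Plane => (p, x))
  have hgp : ∀ p, ContDiff ℝ 1 (g p) := fun p =>
    hg.comp (contDiff_prodMk_right p)
  have hg2 : Continuous fun q : (Plane × Plane) × Plane => fderiv ℝ (g q.1) q.2 := by
    have : ContDiff ℝ 1 (Function.uncurry fun (q : (Plane × Plane) × Plane) (y : Plane) =>
        g q.1 y) :=
      hg.comp (by fun_prop : ContDiff ℝ 1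
        fun z : ((Plane × Plane) × Plane) × Plane => (z.1.1, z.2))
    exact (ContDiff.fderiv (n := 0) this contDiff_snd (by simp)).continuous
  obtain ⟨C, hC⟩ := (hS.prod (isCompact_closedBall x 1)).exists_bound_of_continuousOn
    hg2.continuousOn
  refine hasFDerivAt_integral_of_dominated_of_fderiv_le (s := Metric.closedBall x 1)
    (bound := fun p => ‖W p‖ * C) (F' := fun x p => W p • fderiv ℝ (g p) x)
    (Metric.closedBall_mem_nhds x one_pos) ?_ ?_ ?_ ?_ (hW.norm.mul_const C) ?_
  · exact Eventually.of_forall fun y => hW.aestronglyMeasurable.mul (hc y).aestronglyMeasurable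
  · exact integrable_smul_of_compact hW hS hWS (hc x)
  · exact hW.aestronglyMeasurable.smul (hg2.comp
      (by fun_prop : Continuous fun p : Plane × Plane => (p, x))).aestronglyMeasurable
  · filter_upwards [hWS] with p hp y hy
    rw [norm_smul]
    by_cases h : p ∈ S
    · gcongr
      exact hC (p, y) ⟨h, hy⟩
    · simp [hp h]
  · refine Eventually.of_forall fun p y _ => ?_
    exact ((hgp p).differentiable one_ne_zero y).hasFDerivAt.const_mul (W p)

theorem C1aBound_integral_mul (hW : Integrable W) (hS : IsCompact S)
    (hWS : ∀ᵐ p, p ∉ S → W p = 0) (hg : ContDiff ℝ 1 (Function.uncurry g))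
    (hb : ∀ p ∈ S, C1aBound α M s (g p)) :
    C1aBound α (M * ∫ p, ‖W p‖) s (fun x => ∫ p, W p * g p x) := by
  have hg2 : ∀ x, Continuous fun p : Plane × Plane => fderiv ℝ (g p) x := fun x =>
    (ContDiff.fderiv (n := 0) hg contDiff_const (by simp)).continuous
  refine ⟨fun x hx => ?_, fun x hx => ?_, fun x hx y hy => ?_⟩
  · exact norm_integral_smul_le_of_compact (k := fun p => g p x) hW hWS fun p hp => (hb p hp).val x hx
  · rw [(hasFDerivAt_integral_mul hW hS hWS hg x).fderiv]
    exact norm_integral_smul_le_of_compact hW hWS fun p hp => (hb p hp).der x hx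
  · rw [(hasFDerivAt_integral_mul hW hS hWS hg x).fderiv,
      (hasFDerivAt_integral_mul hW hS hWS hg y).fderiv,
      ← integral_sub (integrable_smul_of_compact hW hS hWS (hg2 x))
        (integrable_smul_of_compact hW hS hWS (hg2 y))]
    simp_rw [← smul_sub]
    refine (norm_integral_smul_le_of_compact (C := M * ‖x - y‖ ^ (α : ℝ)) hW hWS fun p hp => (hb p hp).hol x hx y hy).trans_eq ?_
    ring

end Weighted

end Intensity

/-! ### The Hopkins integral as a function of the mask -/

section Masks

variable {α : ℝ≥0} {M R : ℝ} {s t : Set Plane} {K : Plane → ℂ} {Jhat : Plane → ℝ}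

theorem integrable_mask (u : Plane →₁[volume] ℝ) : Integrable u := L1.integrable_coeFn u

theorem norm_mask_le {u : Plane →₁[volume] ℝ} (hu : u ∈ masks R) :
    ‖u‖ ≤ volume.real (Metric.ball (0 : Plane) R) := by
  rw [L1.norm_eq_integral_norm]
  have : ∫ x, (Metric.ball (0 : Plane) R).indicator (fun _ => (1 : ℝ)) x
      = volume.real (Metric.ball (0 : Plane) R) := by
    rw [integral_indicator measurableSet_ball]
    simp
  rw [← this]
  refine integral_mono_ae (integrable_mask u).norm ?_ ?_
  · exact (integrable_indicator_iff measurableSet_ball).2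
      (integrableOn_const (by exact measure_ball_lt_top.ne))
  · filter_upwards [hu.1, hu.2] with x h1 h2
    by_cases hx : x ∈ Metric.ball (0 : Plane) R
    · rw [indicator_of_mem hx, Real.norm_of_nonneg h1.1]
      exact h1.2
    · simp [h2 hx, hx]

/-- The weight `u(ξ) J(ξ - ζ) u(ζ)` of the Hopkins integral. -/
noncomputable def hopkinsWeight (Jhat u : Plane → ℝ) (p : Plane × Plane) : ℂ :=
  ((u p.1 * u p.2 : ℝ) : ℂ) * mutualIntensity Jhat (p.1 - p.2)

/-- The kernel `K(x - ξ) conj(K(x - ζ))` of the Hopkins integral. -/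
noncomputable def hopkinsKernel (K : Plane → ℂ) (p : Plane × Plane) (x : Plane) : ℂ :=
  K (x - p.1) * (starRingEnd ℂ) (K (x - p.2))

theorem hopkins_eq (K : Plane → ℂ) (Jhat u : Plane → ℝ) (x : Plane) :
    hopkins K Jhat u x = ∫ p, hopkinsWeight Jhat u p * hopkinsKernel K p x := by
  unfold hopkins hopkinsWeight hopkinsKernel
  congr 1
  ext p
  push_cast
  ring

theorem contDiff_hopkinsKernel (hK : ContDiff ℝ 1 K) :
    ContDiff ℝ 1 (Function.uncurry (hopkinsKernel K)) := by
  unfold hopkinsKernel Function.uncurry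
  refine (hK.comp (by fun_prop)).mul ?_
  exact Complex.conjCLE.contDiff.comp (hK.comp (by fun_prop))

theorem C1aBound_hopkinsKernel (hα1 : α ≤ 1) (hs : Convex ℝ s) (hM : 0 ≤ M)
    (hK : ContDiff ℝ 1 K) (h : C1aBound α M t K) {p : Plane × Plane}
    (hp1 : ∀ x ∈ s, x - p.1 ∈ t) (hp2 : ∀ x ∈ s, x - p.2 ∈ t) :
    C1aBound α (6 * M ^ 2) s (hopkinsKernel K p) := by
  have hKd : Differentiable ℝ K := hK.differentiable one_ne_zero
  have shift : ∀ q : Plane, (∀ x ∈ s, x - q ∈ t) → C1aBound α M s (fun x => K (x - q)) := by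
    intro q hq
    refine ⟨fun x hx => h.val _ (hq x hx), fun x hx => ?_, fun x hx y hy => ?_⟩
    · rw [fderiv_comp_sub]
      exact h.der _ (hq x hx)
    · rw [fderiv_comp_sub, fderiv_comp_sub]
      simpa using h.hol _ (hq x hx) _ (hq y hy)
  have hd : ∀ q : Plane, Differentiable ℝ fun x => K (x - q) := fun q =>
    hKd.comp (by fun_prop)
  refine C1aBound.mul hα1 hs (hd _) ?_ hM (shift _ hp1) ?_
  · exact Complex.conjCLE.differentiable.comp (hd p.2)
  · refine (shift _ hp2).clm_comp (hd p.2) (Complex.conjCLE : ℂ →L[ℝ] ℂ) ?_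
    refine ContinuousLinearMap.opNorm_le_bound _ zero_le_one fun z => ?_
    simp

theorem integrable_hopkinsWeight (hJ : Integrable Jhat) {u : Plane → ℝ} (hu : Integrable u) :
    Integrable (hopkinsWeight Jhat u) := by
  have h1 : Integrable (fun p : Plane × Plane => ((u p.1 * u p.2 : ℝ) : ℂ)) :=
    (hu.mul_prod hu).ofReal
  refine h1.mul_bdd (c := (1 / (2 * Real.pi) ^ 2) * ∫ k, ‖Jhat k‖) ?_ ?_
  · exact ((continuous_mutualIntensity hJ).comp (by fun_prop)).aestronglyMeasurable
  · exact Eventually.of_forall fun p => norm_mutualIntensity_le _ _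

theorem hopkinsWeight_eq_zero {u : Plane →₁[volume] ℝ} (hu : u ∈ masks R) :
    ∀ᵐ p : Plane × Plane, p ∉ Metric.closedBall (0 : Plane) R ×ˢ Metric.closedBall (0 : Plane) R →
      hopkinsWeight Jhat u p = 0 := by
  have h1 : ∀ᵐ p : Plane × Plane, p.1 ∉ Metric.ball (0 : Plane) R → u p.1 = 0 :=
    Measure.quasiMeasurePreserving_fst.ae hu.2
  have h2 : ∀ᵐ p : Plane × Plane, p.2 ∉ Metric.ball (0 : Plane) R → u p.2 = 0 :=
    Measure.quasiMeasurePreserving_snd.ae hu.2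
  filter_upwards [h1, h2] with p h1 h2 hp
  rw [mem_prod, not_and_or] at hp
  unfold hopkinsWeight
  rcases hp with hp | hp
  · rw [h1 fun h => hp (Metric.ball_subset_closedBall h)]
    simp
  · rw [h2 fun h => hp (Metric.ball_subset_closedBall h)]
    simp

/-- The function `J` is bounded and `u ⊗ u - v ⊗ v = (u - v) ⊗ u + v ⊗ (u - v)`; Fubini evaluates
the integral of each product. -/
theorem integral_norm_hopkinsWeight_sub_le (Jhat : Plane → ℝ) (u v : Plane →₁[volume] ℝ) :
    ∫ p, ‖hopkinsWeight Jhat u p - hopkinsWeight Jhat v p‖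
      ≤ ((1 / (2 * Real.pi) ^ 2) * ∫ k, ‖Jhat k‖) * ((‖u‖ + ‖v‖) * ‖u - v‖) := by
  set B := (1 / (2 * Real.pi) ^ 2) * ∫ k, ‖Jhat k‖
  have hB : 0 ≤ B := by positivity
  have hiu := integrable_mask u
  have hiv := integrable_mask v
  have hd : Integrable fun x => |u x - v x| := (hiu.sub hiv).norm
  have hn : ∫ x, |u x - v x| = ‖u - v‖ := by
    rw [L1.norm_eq_integral_norm]
    refine integral_congr_ae ?_
    filter_upwards [Lp.coeFn_sub u v] with x hx
    rw [hx]
    rfl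
  have hnu : ∫ x, |u x| = ‖u‖ := (L1.norm_eq_integral_norm u).symm
  have hnv : ∫ x, |v x| = ‖v‖ := (L1.norm_eq_integral_norm v).symm
  have i1 : Integrable fun p : Plane × Plane => |u p.1 - v p.1| * |u p.2| :=
    hd.mul_prod hiu.norm
  have i2 : Integrable fun p : Plane × Plane => |v p.1| * |u p.2 - v p.2| :=
    hiv.norm.mul_prod hd
  have e1 : ∫ p : Plane × Plane, |u p.1 - v p.1| * |u p.2| = ‖u - v‖ * ‖u‖ := by
    rw [← hn, ← hnu]
    exact integral_prod_mul (fun x => |u x - v x|) (fun x => |u x|)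
  have e2 : ∫ p : Plane × Plane, |v p.1| * |u p.2 - v p.2| = ‖v‖ * ‖u - v‖ := by
    rw [← hn, ← hnv]
    exact integral_prod_mul (fun x => |v x|) (fun x => |u x - v x|)
  have e3 : (‖u‖ + ‖v‖) * ‖u - v‖
      = ∫ p : Plane × Plane, (|u p.1 - v p.1| * |u p.2| + |v p.1| * |u p.2 - v p.2|) := by
    rw [integral_add i1 i2, e1, e2]
    ring
  rw [e3, ← integral_const_mul]
  refine integral_mono_of_nonneg (Eventually.of_forall fun _ => norm_nonneg _)
    ((i1.add i2).const_mul B) (Eventually.of_forall fun p => ?_)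
  have e : hopkinsWeight Jhat u p - hopkinsWeight Jhat v p
      = (((u p.1 - v p.1) * u p.2 + v p.1 * (u p.2 - v p.2) : ℝ) : ℂ)
        * mutualIntensity Jhat (p.1 - p.2) := by
    unfold hopkinsWeight
    push_cast
    ring
  simp only [e]
  rw [norm_mul, mul_comm, Complex.norm_real]
  gcongr
  · exact norm_mutualIntensity_le _ _
  · refine (norm_add_le _ _).trans_eq ?_
    rw [norm_mul, norm_mul]
    rfl

theorem differentiable_intensity (hK : ContDiff ℝ 1 K) (hJ : Integrable Jhat)
    {u : Plane →₁[volume] ℝ} (hu : u ∈ masks R) : Differentiable ℝ (intensity K Jhat u) := by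
  intro x
  have := hasFDerivAt_integral_mul (integrable_hopkinsWeight hJ (integrable_mask u))
    ((isCompact_closedBall (0 : Plane) R).prod (isCompact_closedBall (0 : Plane) R))
    (hopkinsWeight_eq_zero (Jhat := Jhat) hu) (contDiff_hopkinsKernel hK) x
  have h2 := (Complex.reCLM.hasFDerivAt.comp x this).differentiableAt
  refine h2.congr_of_eventuallyEq (Eventually.of_forall fun y => ?_)
  simp [intensity, hopkins_eq]

/-- Lipschitz dependence of the intensity on the mask. -/
theorem exists_C1aBound_intensity_sub (hα1 : α ≤ 1) (hs : Convex ℝ s) (hM : 0 ≤ M)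
    (hK : ContDiff ℝ 1 K) (h : C1aBound α M t K) (hJ : Integrable Jhat)
    (hst : ∀ x ∈ s, ∀ q ∈ Metric.closedBall (0 : Plane) R, x - q ∈ t) :
    ∃ C, 0 ≤ C ∧ ∀ u ∈ masks R, ∀ v ∈ masks R, C1aBound α (C * ‖u - v‖) s
      (fun x => intensity K Jhat u x - intensity K Jhat v x) := by
  set V := volume.real (Metric.ball (0 : Plane) R)
  -- The factor `6 M²` bounds the kernel, the next one bounds `J`, and `V + V` bounds `‖u‖ + ‖v‖`.
  refine ⟨6 * M ^ 2 * (((1 / (2 * Real.pi) ^ 2) * ∫ k, ‖Jhat k‖) * (V + V)), by positivity,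
    fun u hu v hv => ?_⟩
  have hS : IsCompact (Metric.closedBall (0 : Plane) R ×ˢ Metric.closedBall (0 : Plane) R) :=
    (isCompact_closedBall (0 : Plane) R).prod (isCompact_closedBall (0 : Plane) R)
  have hiu := integrable_hopkinsWeight hJ (integrable_mask u)
  have hiv := integrable_hopkinsWeight hJ (integrable_mask v)
  have hu0 := hopkinsWeight_eq_zero (Jhat := Jhat) hu
  have hv0 := hopkinsWeight_eq_zero (Jhat := Jhat) hv
  have hW : Integrable fun p => hopkinsWeight Jhat u p - hopkinsWeight Jhat v p := hiu.sub hiv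
  have hW0 : ∀ᵐ p : Plane × Plane,
      p ∉ Metric.closedBall (0 : Plane) R ×ˢ Metric.closedBall (0 : Plane) R →
      hopkinsWeight Jhat u p - hopkinsWeight Jhat v p = 0 := by
    filter_upwards [hu0, hv0] with p h1 h2 hp
    rw [h1 hp, h2 hp, sub_zero]
  have hg := contDiff_hopkinsKernel hK
  have hk : ∀ x, Continuous fun p => hopkinsKernel K p x := fun x =>
    hg.continuous.comp (by fun_prop : Continuous fun p : Plane × Plane => (p, x))
  have hb := C1aBound_integral_mul (M := 6 * M ^ 2) (s := s) hW hS hW0 hg fun p hp =>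
    C1aBound_hopkinsKernel hα1 hs hM hK h (fun x hx => hst x hx _ hp.1)
      (fun x hx => hst x hx _ hp.2)
  have hb2 := hb.clm_comp (fun x => (hasFDerivAt_integral_mul hW hS hW0 hg x).differentiableAt)
    Complex.reCLM (by simp)
  have e : (fun x => intensity K Jhat u x - intensity K Jhat v x) = fun x => Complex.reCLM
      (∫ p, (hopkinsWeight Jhat u p - hopkinsWeight Jhat v p) * hopkinsKernel K p x) := by
    ext x
    simp_rw [sub_mul]
    have := integral_sub (integrable_smul_of_compact hiu hS hu0 (hk x))
      (integrable_smul_of_compact hiv hS hv0 (hk x))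
    simp only [smul_eq_mul] at this
    rw [this]
    simp [intensity, hopkins_eq]
  rw [e]
  refine hb2.mono ?_ Subset.rfl
  rw [mul_assoc (6 * M ^ 2)]
  refine mul_le_mul_of_nonneg_left ?_ (by positivity)
  refine (integral_norm_hopkinsWeight_sub_le Jhat u v).trans ?_
  rw [mul_assoc (_ * _)]
  gcongr
  · exact norm_mask_le hu
  · exact norm_mask_le hv

theorem zero_mem_masks : (0 : Plane →₁[volume] ℝ) ∈ masks R := by
  have h := Lp.coeFn_zero ℝ 1 (volume : Measure Plane)
  constructor
  · filter_upwards [h] with x hx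
    rw [hx]
    simp
  · filter_upwards [h] with x hx _
    rw [hx]
    rfl

theorem intensity_zero (x : Plane) :
    intensity K Jhat (0 : Plane →₁[volume] ℝ) x = 0 := by
  have h := Lp.coeFn_zero ℝ 1 (volume : Measure Plane)
  have h1 : ∀ᵐ p : Plane × Plane, (0 : Plane →₁[volume] ℝ) p.1 = 0 :=
    Measure.quasiMeasurePreserving_fst.ae h
  have : hopkins K Jhat (0 : Plane →₁[volume] ℝ) x = 0 := by
    rw [hopkins_eq]
    refine integral_eq_zero_of_ae ?_
    filter_upwards [h1] with p hp
    rw [hopkinsWeight, hp]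
    simp
  rw [intensity, this]
  rfl

/-- This is the Lipschitz estimate against the zero mask, whose intensity vanishes; masks have norm
at most the area of the ball. -/
theorem exists_C1aBound_intensity (hα1 : α ≤ 1) (hs : Convex ℝ s) (hM : 0 ≤ M)
    (hK : ContDiff ℝ 1 K) (h : C1aBound α M t K) (hJ : Integrable Jhat)
    (hst : ∀ x ∈ s, ∀ q ∈ Metric.closedBall (0 : Plane) R, x - q ∈ t) :
    ∃ C, 0 ≤ C ∧ ∀ u ∈ masks R, C1aBound α C s (intensity K Jhat u) := by
  obtain ⟨C, hC, hb⟩ := exists_C1aBound_intensity_sub (Jhat := Jhat) hα1 hs hM hK h hJ hst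
  refine ⟨C * volume.real (Metric.ball (0 : Plane) R), by positivity, fun u hu => ?_⟩
  have := hb u hu 0 zero_mem_masks
  simp only [intensity_zero, sub_zero] at this
  exact this.mono (mul_le_mul_of_nonneg_left (norm_mask_le hu) hC) Subset.rfl

theorem IsC1aLoc.exists_C1aBound_intensity (hα1 : α ≤ 1) (hK : IsC1aLoc α K)
    (hJ : Integrable Jhat) (r : ℝ) :
    ∃ C, 0 ≤ C ∧ ∀ u ∈ masks R, C1aBound α C (Metric.ball 0 r) (intensity K Jhat u) := by
  obtain ⟨M, hM, hb⟩ := hK.exists_bound (r + R)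
  refine Photolith.exists_C1aBound_intensity hα1 (convex_ball _ _) hM hK.contDiff hb hJ
    fun x hx q hq => ?_
  rw [mem_ball_zero_iff] at hx ⊢
  rw [mem_closedBall_zero_iff] at hq
  exact (norm_sub_le _ _).trans_lt (add_lt_add_of_lt_of_le hx hq)

theorem IsC1aLoc.exists_C1aBound_intensity_sub (hα1 : α ≤ 1) (hK : IsC1aLoc α K)
    (hJ : Integrable Jhat) (r : ℝ) :
    ∃ C, 0 ≤ C ∧ ∀ u ∈ masks R, ∀ v ∈ masks R, C1aBound α (C * ‖u - v‖) (Metric.ball 0 r)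
      (fun x => intensity K Jhat u x - intensity K Jhat v x) := by
  obtain ⟨M, hM, hb⟩ := hK.exists_bound (r + R)
  refine Photolith.exists_C1aBound_intensity_sub hα1 (convex_ball _ _) hM hK.contDiff hb hJ
    fun x hx q hq => ?_
  rw [mem_ball_zero_iff] at hx ⊢
  rw [mem_closedBall_zero_iff] at hq
  exact (norm_sub_le _ _).trans_lt (add_lt_add_of_lt_of_le hx hq)

theorem contDiff_intensity (hα0 : 0 < α) (hα1 : α ≤ 1) (hK : IsC1aLoc α K)
    (hJ : Integrable Jhat) {u : Plane →₁[volume] ℝ} (hu : u ∈ masks R) :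
    ContDiff ℝ 1 (intensity K Jhat u) :=
  contDiff_of_C1aBound hα0 (differentiable_intensity hK.contDiff hJ hu) fun r =>
    (hK.exists_C1aBound_intensity hα1 hJ r).imp fun _ h => ⟨h.1, h.2 u hu⟩

end Masks

/-! ### Decay of the intensity and the smooth threshold map -/

section Threshold

variable {α : ℝ≥0} {R : ℝ} {K : Plane → ℂ} {Jhat : Plane → ℝ} {φ : ℝ → ℝ}

/-- Masks are supported in a fixed ball, so for large `x` both factors of the kernel are evaluated
far from the origin, where `K` is small. The total mass of the weight is bounded independently of
the mask. -/
theorem exists_abs_intensity_lt (hK : Tendsto K (cocompact Plane) (𝓝 0)) (hJ : Integrable Jhat)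
    {t₀ : ℝ} (ht₀ : 0 < t₀) :
    ∃ r, ∀ u ∈ masks R, ∀ x : Plane, r ≤ ‖x‖ → |intensity K Jhat u x| < t₀ := by
  set V := volume.real (Metric.ball (0 : Plane) R)
  set B := (1 / (2 * Real.pi) ^ 2) * ∫ k, ‖Jhat k‖
  have hB : 0 ≤ B := by positivity
  have hV : 0 ≤ V := measureReal_nonneg
  obtain ⟨κ, hκ, hκt⟩ : ∃ κ : ℝ, 0 < κ ∧ κ ^ 2 * (B * (V * V)) < t₀ := by
    have : Tendsto (fun κ : ℝ => κ ^ 2 * (B * (V * V))) (𝓝[>] 0) (𝓝 0) := by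
      have h : ContinuousAt (fun κ : ℝ => κ ^ 2 * (B * (V * V))) 0 := by fun_prop
      simpa using h.tendsto.mono_left nhdsWithin_le_nhds
    exact ((eventually_mem_nhdsWithin).and (this.eventually_lt_const ht₀)).exists
  have hev : ∀ᶠ y in cocompact Plane, ‖K y‖ ≤ κ := by
    have := (tendsto_zero_iff_norm_tendsto_zero.1 hK).eventually_lt_const hκ
    exact this.mono fun _ h => h.le
  rw [← Metric.cobounded_eq_cocompact, ← comap_norm_atTop, eventually_comap, eventually_atTop] at hev
  obtain ⟨r, hr⟩ := hev
  refine ⟨r + R, fun u hu x hx => ?_⟩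
  have hker : ∀ p ∈ Metric.closedBall (0 : Plane) R ×ˢ Metric.closedBall (0 : Plane) R,
      ‖hopkinsKernel K p x‖ ≤ κ ^ 2 := by
    have far : ∀ q ∈ Metric.closedBall (0 : Plane) R, ‖K (x - q)‖ ≤ κ := fun q hq => by
      refine hr _ ?_ _ rfl
      rw [mem_closedBall_zero_iff] at hq
      linarith [norm_sub_norm_le x q]
    intro p hp
    rw [hopkinsKernel, norm_mul, RCLike.norm_conj, sq]
    exact mul_le_mul (far _ hp.1) (far _ hp.2) (norm_nonneg _) hκ.le
  have h1 := norm_integral_smul_le_of_compact (integrable_hopkinsWeight hJ (integrable_mask u))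
    (hopkinsWeight_eq_zero (Jhat := Jhat) hu) hker
  have h2 : ∫ p, ‖hopkinsWeight Jhat u p‖ ≤ B * (V * V) := by
    have h := integral_norm_hopkinsWeight_sub_le Jhat u 0
    have h0 : ∫ p, ‖hopkinsWeight Jhat u p - hopkinsWeight Jhat (0 : Plane →₁[volume] ℝ) p‖
        = ∫ p, ‖hopkinsWeight Jhat u p‖ := by
      refine integral_congr_ae ?_
      -- The zero mask is admissible for every radius. For radius `-1` the closed ball is empty, so
      -- the weight vanishes almost everywhere.
      filter_upwards [hopkinsWeight_eq_zero (R := -1) (Jhat := Jhat) zero_mem_masks] with p hp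
      rw [hp (by simp), sub_zero]
    rw [h0, norm_zero, add_zero, sub_zero] at h
    refine h.trans (mul_le_mul_of_nonneg_left ?_ hB)
    exact mul_le_mul (norm_mask_le hu) (norm_mask_le hu) (norm_nonneg _) hV
  calc |intensity K Jhat u x| ≤ ‖hopkins K Jhat u x‖ := Complex.abs_re_le_norm _
    _ ≤ κ ^ 2 * ∫ p, ‖hopkinsWeight Jhat u p‖ := by
      rw [hopkins_eq]
      exact h1
    _ ≤ κ ^ 2 * (B * (V * V)) := by gcongr
    _ < t₀ := hκt

theorem exists_exposed_subset_ball (hK : Tendsto K (cocompact Plane) (𝓝 0))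
    (hJ : Integrable Jhat) {t₀ : ℝ} (ht₀ : 0 < t₀) (R : ℝ) :
    ∃ R₁, R ≤ R₁ ∧ ∀ u ∈ masks R, ∀ t, t₀ ≤ t → exposed K Jhat t u ⊆ Metric.ball 0 R₁ := by
  obtain ⟨r, hr⟩ := exists_abs_intensity_lt (R := R) hK hJ ht₀
  refine ⟨max r R, le_max_right _ _, fun u hu t ht x hx => ?_⟩
  rw [mem_ball_zero_iff]
  by_contra hlt
  have h1 := hr u hu x ((le_max_left _ _).trans (not_lt.1 hlt))
  have h2 : t < intensity K Jhat u x := hx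
  linarith [le_abs_self (intensity K Jhat u x)]

theorem profile_nonneg (hφ_mono : Monotone φ) (hφ_zero : ∀ t, t ≤ -(1 / 2) → φ t = 0) (t : ℝ) :
    0 ≤ φ t := by
  rw [← hφ_zero (min t (-(1 / 2))) (min_le_right _ _)]
  exact hφ_mono (min_le_left _ _)

theorem profile_le_one (hφ_mono : Monotone φ) (hφ_one : ∀ t, 1 / 2 ≤ t → φ t = 1) (t : ℝ) :
    φ t ≤ 1 := by
  rw [← hφ_one (max t (1 / 2)) (le_max_right _ _)]
  exact hφ_mono (le_max_left _ _)

/-- At `t = ±1/2` the profile is constant on one side only. The one-sided derivative determines the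
derivative, so the endpoints are included. -/
theorem deriv_profile_eq_zero (hφ : Differentiable ℝ φ) (hφ_zero : ∀ t, t ≤ -(1 / 2) → φ t = 0)
    (hφ_one : ∀ t, 1 / 2 ≤ t → φ t = 1) {t : ℝ} (ht : 1 / 2 ≤ |t|) : deriv φ t = 0 := by
  have hd := (hφ t).hasDerivAt
  rcases le_abs.1 ht with h | h
  · have h1 : HasDerivWithinAt φ 0 (Ici t) t :=
      (hasDerivWithinAt_const t (Ici t) (1 : ℝ)).congr (fun y hy => hφ_one y (h.trans hy))
        (hφ_one t h)
    exact (uniqueDiffWithinAt_Ici t).eq_deriv _ hd.hasDerivWithinAt h1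
  · have h1 : HasDerivWithinAt φ 0 (Iic t) t :=
      (hasDerivWithinAt_const t (Iic t) (0 : ℝ)).congr
        (fun y hy => hφ_zero y (le_trans hy (by linarith))) (hφ_zero t (by linarith))
    exact (uniqueDiffWithinAt_Iic t).eq_deriv _ hd.hasDerivWithinAt h1

/-- The rescaled profile `t ↦ φ((t - h)/η)` has bounded derivatives up to order three. -/
theorem exists_profile_bound (hφ : ContDiff ℝ ∞ φ) (hφ_mono : Monotone φ)
    (hφ_zero : ∀ t, t ≤ -(1 / 2) → φ t = 0) (hφ_one : ∀ t, 1 / 2 ≤ t → φ t = 1) (h : ℝ) {η : ℝ}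
    (hη : 0 < η) : ∃ F : ℝ → ℝ, (∀ t, F t = φ ((t - h) / η)) ∧ Differentiable ℝ F ∧
      Differentiable ℝ (deriv F) ∧ Differentiable ℝ (deriv (deriv F)) ∧
      ∃ N, 0 ≤ N ∧ (∀ t, |F t| ≤ N) ∧ (∀ t, |deriv F t| ≤ N) ∧ (∀ t, |deriv (deriv F) t| ≤ N) ∧
        ∀ t, |deriv (deriv (deriv F)) t| ≤ N := by
  set F : ℝ → ℝ := fun t => φ ((t - h) / η) with hFdef
  have hF : ContDiff ℝ ∞ F := hφ.comp (by fun_prop)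
  have hF1 : ContDiff ℝ ∞ (deriv F) := (contDiff_infty_iff_deriv.1 hF).2
  have hF2 : ContDiff ℝ ∞ (deriv (deriv F)) := (contDiff_infty_iff_deriv.1 hF1).2
  have hF3 : ContDiff ℝ ∞ (deriv (deriv (deriv F))) := (contDiff_infty_iff_deriv.1 hF2).2
  have hφd : Differentiable ℝ φ := hφ.differentiable (by simp)
  -- The rescaled profile is not compactly supported, but its derivative is, so the higher
  -- derivatives are bounded by compactness.
  have hc1 : HasCompactSupport (deriv F) := by
    refine HasCompactSupport.intro (isCompact_closedBall h (η / 2)) fun t ht => ?_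
    have e : deriv F t = deriv φ ((t - h) / η) * (1 / η) := by
      have h1 : HasDerivAt (fun t => (t - h) / η) (1 / η) t :=
        ((hasDerivAt_id t).sub_const h).div_const η
      exact ((hφd _).hasDerivAt.comp t h1).deriv
    rw [e, deriv_profile_eq_zero hφd hφ_zero hφ_one, zero_mul]
    rw [Metric.mem_closedBall, not_le, Real.dist_eq] at ht
    rw [abs_div, abs_of_pos hη, le_div_iff₀ hη]
    linarith
  obtain ⟨N1, h1⟩ := hc1.exists_bound_of_continuous hF1.continuous
  obtain ⟨N2, h2⟩ := hc1.deriv.exists_bound_of_continuous hF2.continuous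
  obtain ⟨N3, h3⟩ := hc1.deriv.deriv.exists_bound_of_continuous hF3.continuous
  have n1 := (norm_nonneg _).trans (h1 0)
  have n2 := (norm_nonneg _).trans (h2 0)
  have n3 := (norm_nonneg _).trans (h3 0)
  refine ⟨F, fun t => rfl, hF.differentiable (by simp), hF1.differentiable (by simp),
    hF2.differentiable (by simp), 1 + N1 + N2 + N3, by positivity, fun t => ?_, fun t => ?_,
    fun t => ?_, fun t => ?_⟩
  · rw [abs_of_nonneg (profile_nonneg hφ_mono hφ_zero _)]
    linarith [profile_le_one hφ_mono hφ_one ((t - h) / η)]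
  · have := h1 t
    rw [Real.norm_eq_abs] at this
    linarith
  · have := h2 t
    rw [Real.norm_eq_abs] at this
    linarith
  · have := h3 t
    rw [Real.norm_eq_abs] at this
    linarith

theorem contDiff_smoothMap (hα0 : 0 < α) (hα1 : α ≤ 1) (hK : IsC1aLoc α K) (hJ : Integrable Jhat)
    (hφ : ContDiff ℝ ∞ φ) (h η : ℝ) {u : Plane →₁[volume] ℝ} (hu : u ∈ masks R) :
    ContDiff ℝ 1 (smoothMap K Jhat h φ η u) := by
  have := contDiff_intensity hα0 hα1 hK hJ hu
  exact (hφ.of_le (by simp)).comp ((this.sub contDiff_const).div_const η)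

theorem isC1a_smoothMap (hα0 : 0 < α) (hα1 : α ≤ 1) (hK : IsC1aLoc α K) (hJ : Integrable Jhat)
    (hφ : ContDiff ℝ ∞ φ) (hφ_mono : Monotone φ) (hφ_zero : ∀ t, t ≤ -(1 / 2) → φ t = 0)
    (hφ_one : ∀ t, 1 / 2 ≤ t → φ t = 1) (h : ℝ) {η : ℝ} (hη : 0 < η)
    {u : Plane →₁[volume] ℝ} (hu : u ∈ masks R) {s : Set Plane} (hs : Convex ℝ s) {M : ℝ}
    (hM : 0 ≤ M) (hI : C1aBound α M s (intensity K Jhat u)) :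
    IsC1a α s (smoothMap K Jhat h φ η u) := by
  obtain ⟨F, hF, d0, d1, -, N, hN, b0, b1, b2, -⟩ :=
    exists_profile_bound hφ hφ_mono hφ_zero hφ_one h hη
  have hb := hI.comp hα1 hs d0 d1 hN hM b0 b1 b2
    (differentiable_intensity hK.contDiff hJ hu)
  have e : (fun x => F (intensity K Jhat u x)) = smoothMap K Jhat h φ η u := by
    ext x
    rw [hF]
    rfl
  rw [e] at hb
  exact hb.isC1a (contDiff_smoothMap hα0 hα1 hK hJ hφ h η hu) (by positivity)

theorem exists_c1aNorm_smoothMap_sub_le (hα1 : α ≤ 1) (hK : IsC1aLoc α K)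
    (hJ : Integrable Jhat)
    (hφ : ContDiff ℝ ∞ φ) (hφ_mono : Monotone φ) (hφ_zero : ∀ t, t ≤ -(1 / 2) → φ t = 0)
    (hφ_one : ∀ t, 1 / 2 ≤ t → φ t = 1) (h R r : ℝ) {η : ℝ} (hη : 0 < η) :
    ∃ C, 0 ≤ C ∧ ∀ u ∈ masks R, ∀ v ∈ masks R, c1aNorm α (Metric.ball 0 r)
      (fun x => smoothMap K Jhat h φ η u x - smoothMap K Jhat h φ η v x)
        ≤ ENNReal.ofReal (C * ‖u - v‖) := by
  obtain ⟨F, hF, d0, d1, d2, N, hN, b0, b1, b2, b3⟩ :=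
    exists_profile_bound hφ hφ_mono hφ_zero hφ_one h hη
  obtain ⟨M, hM, hI⟩ := hK.exists_C1aBound_intensity (R := R) hα1 hJ r
  obtain ⟨m, hm, hD⟩ := hK.exists_C1aBound_intensity_sub (R := R) hα1 hJ r
  refine ⟨3 * (N * (1 + 3 * M) * (1 + 3 * M) * m), by positivity, fun u hu v hv => ?_⟩
  have hb := C1aBound.comp_sub hα1 (convex_ball _ _) d0 d1 d2 hN hM (by positivity) b1 b2 b3
    (differentiable_intensity hK.contDiff hJ hu) (differentiable_intensity hK.contDiff hJ hv)
    (hI u hu) (hI v hv) (hD u hu v hv)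
  have e : (fun x => F (intensity K Jhat u x) - F (intensity K Jhat v x))
      = fun x => smoothMap K Jhat h φ η u x - smoothMap K Jhat h φ η v x := by
    ext x
    rw [hF, hF]
    rfl
  rw [e] at hb
  refine (hb.c1aNorm_le (by positivity)).trans_eq ?_
  congr 1
  ring

end Threshold

/-! ### Nondegeneracy of the gradient -/

section Nondegeneracy

variable {α : ℝ≥0}

/-- In polar coordinates of the plane the integrand becomes `y⁻² · y = y⁻¹`, which is not integrable
at `0`. -/
theorem lintegral_inv_sq_norm_eq_top {r : ℝ} (hr : 0 < r) :
    ∫⁻ x in Metric.ball (0 : Plane) r, ENNReal.ofReal ((‖x‖ ^ 2)⁻¹) = ⊤ := by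
  by_contra hne
  have hm : Measurable fun x : Plane => (‖x‖ ^ 2)⁻¹ := by fun_prop
  have hint : IntegrableOn (fun x : Plane => (‖x‖ ^ 2)⁻¹) (Metric.ball 0 r) := by
    refine ⟨hm.aestronglyMeasurable, ?_⟩
    rw [hasFiniteIntegral_iff_ofReal (Eventually.of_forall fun x => by positivity)]
    exact lt_top_iff_ne_top.2 hne
  have h2 := (integrableOn_fun_norm_addHaar (volume : Measure Plane)
    (f := fun y : ℝ => (y ^ 2)⁻¹)).1 hint
  have h3 : IntegrableOn (fun y : ℝ => y ^ (-1 : ℝ)) (Ioo 0 r) := by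
    refine h2.congr_fun (fun y hy => ?_) measurableSet_Ioo
    have hy0 : y ≠ 0 := hy.1.ne'
    simp only [finrank_euclideanSpace, Fintype.card_fin, smul_eq_mul, Real.rpow_neg_one]
    field_simp
    norm_num
  have h4 := (intervalIntegral.integrableOn_Ioo_rpow_iff hr).1 h3
  exact lt_irrefl _ h4

/-- Near `0` the liminf condition gives `f(s) ≥ c s^(-2/α)`. Since `f` is nonincreasing, inserting
the upper bound `s = L|x - x₀|^α` for `g` bounds `f ∘ g` below by a multiple of `|x - x₀|⁻²`. -/
theorem lintegral_comp_eq_top (hα0 : 0 < α) {f : ℝ → ℝ≥0∞} (hf_anti : Antitone f)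
    (hf_lim : 0 < liminf (fun s : ℝ => f s * ENNReal.ofReal (s ^ (2 / (α : ℝ)))) (𝓝[>] 0))
    {g : Plane → ℝ} {x₀ : Plane} {L r₀ : ℝ} (hL : 0 < L) (hr₀ : 0 < r₀)
    (hg : ∀ x ∈ Metric.ball x₀ r₀, g x ≤ L * ‖x - x₀‖ ^ (α : ℝ)) : ∫⁻ x, f (g x) = ⊤ := by
  have hα : (0 : ℝ) < α := by exact_mod_cast hα0
  obtain ⟨c, hc0, hc⟩ := exists_between hf_lim
  have hev := eventually_lt_of_lt_liminf hc
  have hctop : c ≠ ⊤ := by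
    obtain ⟨s, hs⟩ := hev.exists
    exact hs.ne_top
  obtain ⟨s₁, hs₁, hcs⟩ := mem_nhdsGT_iff_exists_Ioo_subset.1 hev
  have hs₁ : 0 < s₁ := hs₁
  -- The radius is small enough that `L‖x‖^α` stays in the interval where the lower bound for `f`
  -- holds.
  obtain ⟨r, hr, hr₁, hrs⟩ : ∃ r, 0 < r ∧ r ≤ r₀ ∧ L * r ^ (α : ℝ) ≤ s₁ := by
    refine ⟨min r₀ ((s₁ / L) ^ (1 / (α : ℝ))), by positivity, min_le_left _ _, ?_⟩
    have h1 : (min r₀ ((s₁ / L) ^ (1 / (α : ℝ)))) ^ (α : ℝ)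
        ≤ ((s₁ / L) ^ (1 / (α : ℝ))) ^ (α : ℝ) := by
      gcongr
      exact min_le_right _ _
    rw [← Real.rpow_mul (by positivity), one_div_mul_cancel hα.ne', Real.rpow_one] at h1
    calc _ ≤ L * (s₁ / L) := by gcongr
      _ = s₁ := by field_simp
  set A : ℝ := L ^ (2 / (α : ℝ)) with hA
  have hApos : 0 < A := by positivity
  have hlow : ∀ x ∈ Metric.ball (0 : Plane) r,
      c / ENNReal.ofReal A * ENNReal.ofReal ((‖x‖ ^ 2)⁻¹) ≤ f (g (x + x₀)) := by
    intro x hx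
    rw [mem_ball_zero_iff] at hx
    rcases eq_or_ne x 0 with rfl | hx0
    · simp
    have hn : 0 < ‖x‖ := norm_pos_iff.2 hx0
    have hgx : g (x + x₀) ≤ L * ‖x‖ ^ (α : ℝ) := by
      have := hg (x + x₀) (by simpa using hx.trans_le hr₁)
      simpa using this
    refine le_trans ?_ (hf_anti hgx)
    have hs : L * ‖x‖ ^ (α : ℝ) ∈ Ioo 0 s₁ := by
      refine ⟨by positivity, lt_of_lt_of_le ?_ hrs⟩
      gcongr
    have h1 : c < f (L * ‖x‖ ^ (α : ℝ)) * ENNReal.ofReal ((L * ‖x‖ ^ (α : ℝ)) ^ (2 / (α : ℝ))) :=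
      hcs hs
    have e : (L * ‖x‖ ^ (α : ℝ)) ^ (2 / (α : ℝ)) = A * ‖x‖ ^ 2 := by
      rw [Real.mul_rpow hL.le (by positivity), ← Real.rpow_mul hn.le,
        mul_div_cancel₀ _ hα.ne', Real.rpow_two]
    rw [e] at h1
    have h2 := ENNReal.div_le_of_le_mul h1.le
    refine le_trans (le_of_eq ?_) h2
    rw [ENNReal.ofReal_mul hApos.le, ENNReal.ofReal_inv_of_pos (by positivity),
      div_eq_mul_inv, div_eq_mul_inv, ENNReal.mul_inv (Or.inl (by simpa using hApos))
      (Or.inl ENNReal.ofReal_ne_top), mul_assoc]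
  rw [eq_top_iff]
  calc ⊤ = c / ENNReal.ofReal A
        * ∫⁻ x in Metric.ball (0 : Plane) r, ENNReal.ofReal ((‖x‖ ^ 2)⁻¹) := by
        rw [lintegral_inv_sq_norm_eq_top hr, ENNReal.mul_top]
        exact (ENNReal.div_pos hc0.ne' ENNReal.ofReal_ne_top).ne'
    _ = ∫⁻ x in Metric.ball (0 : Plane) r,
        c / ENNReal.ofReal A * ENNReal.ofReal ((‖x‖ ^ 2)⁻¹) := by
        rw [lintegral_const_mul]
        fun_prop
    _ ≤ ∫⁻ x in Metric.ball (0 : Plane) r, f (g (x + x₀)) :=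
        setLIntegral_mono' measurableSet_ball hlow
    _ ≤ ∫⁻ x, f (g (x + x₀)) := setLIntegral_le_lintegral _ _
    _ = ∫⁻ x, f (g x) := lintegral_add_right_eq_self (fun x => f (g x)) x₀

theorem norm_gradient_eq (I : Plane → ℝ) (x : Plane) : ‖gradient I x‖ = ‖fderiv ℝ I x‖ := by
  simp [gradient]

/-- A finite regularization term forces `|∇I|² > ψ(I)` everywhere. -/
theorem lt_sq_norm_fderiv (hα0 : 0 < α) (hα1 : α ≤ 1) {f : ℝ → ℝ≥0∞} (hf_anti : Antitone f)
    (hf_lim : 0 < liminf (fun s : ℝ => f s * ENNReal.ofReal (s ^ (2 / (α : ℝ)))) (𝓝[>] 0))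
    {ψ : ℝ → ℝ} (hψ : ContDiff ℝ 1 ψ) {I : Plane → ℝ} (hI : Differentiable ℝ I)
    (hb : ∀ r : ℝ, ∃ M, 0 ≤ M ∧ C1aBound α M (Metric.ball 0 r) I)
    (hfin : ∫⁻ x, f (‖gradient I x‖ ^ 2 - ψ (I x)) < ⊤) (x₀ : Plane) :
    ψ (I x₀) < ‖fderiv ℝ I x₀‖ ^ 2 := by
  by_contra hle
  obtain ⟨M, hM, hB⟩ := hb (‖x₀‖ + 1)
  obtain ⟨P, hP⟩ := (isCompact_Icc (a := -M) (b := M)).exists_bound_of_continuousOn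
    (hψ.continuous_deriv le_rfl).continuousOn
  have hP0 : 0 ≤ P := (norm_nonneg _).trans (hP 0 ⟨by linarith, hM⟩)
  have hx₀ : x₀ ∈ Metric.ball (0 : Plane) (‖x₀‖ + 1) := by simp
  -- In `L`, the term `2 * M * M` comes from the difference of the squared gradients and `P * (2 *
  -- M)` from `ψ ∘ I`, with `P` bounding `ψ'` on `[-M, M]`; the `1` makes `L` positive. The value at
  -- `x₀` is nonpositive by contradiction hypothesis.
  refine hfin.ne (lintegral_comp_eq_top hα0 hf_anti hf_lim (x₀ := x₀)
    (L := 2 * M * M + P * (2 * M) + 1) (r₀ := 1) (by positivity) one_pos fun x hx => ?_)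
  have hx' : x ∈ Metric.ball (0 : Plane) (‖x₀‖ + 1) := by
    rw [mem_ball_zero_iff]
    rw [mem_ball_iff_norm] at hx
    linarith [norm_sub_norm_le x x₀]
  set ρ := ‖x - x₀‖ ^ (α : ℝ) with hρ
  have hρ0 : 0 ≤ ρ := by positivity
  have h1 : ‖fderiv ℝ I x‖ - ‖fderiv ℝ I x₀‖ ≤ M * ρ :=
    (norm_sub_norm_le _ _).trans (hB.hol x hx' x₀ hx₀)
  have h2 : |I x - I x₀| ≤ 2 * M * ρ :=
    hB.norm_sub_le hα1 (convex_ball _ _) hI hM hx' hx₀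
  have h3 : |ψ (I x) - ψ (I x₀)| ≤ P * |I x - I x₀| :=
    (convex_Icc (-M) M).norm_image_sub_le_of_norm_deriv_le
      (fun t _ => hψ.differentiable one_ne_zero t) hP (abs_le.1 (hB.val x₀ hx₀))
      (abs_le.1 (hB.val x hx'))
  have h4 := mul_le_mul_of_nonneg_left h2 hP0
  have h5 := (abs_le.1 h3).1
  have h6 : ‖fderiv ℝ I x‖ ^ 2 - ‖fderiv ℝ I x₀‖ ^ 2 ≤ (M * ρ) * (2 * M) := by
    have e : ‖fderiv ℝ I x‖ ^ 2 - ‖fderiv ℝ I x₀‖ ^ 2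
      = (‖fderiv ℝ I x‖ - ‖fderiv ℝ I x₀‖) * (‖fderiv ℝ I x‖ + ‖fderiv ℝ I x₀‖) := by ring
    rw [e]
    refine mul_le_mul h1 ?_ (by positivity) (by positivity)
    linarith [hB.der x hx', hB.der x₀ hx₀]
  rw [norm_gradient_eq]
  nlinarith

end Nondegeneracy

/-! ### Total variation and test fields -/

section TotalVariation

variable {D : Set Plane} {X : Plane → Plane}

/-- The fields competing in the definition of the total variation in `D`. -/
structure IsTestField (D : Set Plane) (X : Plane → Plane) : Prop where
  contDiff : ContDiff ℝ 1 X
  hasCompactSupport : HasCompactSupport X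
  tsupport_subset : tsupport X ⊆ D
  norm_le : ∀ x, ‖X x‖ ≤ 1

theorem IsTestField.le_totalVar (hX : IsTestField D X) (f : Plane → ℝ) :
    ENNReal.ofReal (∫ x in D, f x * divergence X x) ≤ totalVar D f :=
  le_iSup_of_le X <| le_iSup_of_le hX.contDiff <| le_iSup_of_le hX.hasCompactSupport <|
    le_iSup_of_le hX.tsupport_subset <| le_iSup_of_le hX.norm_le le_rfl

theorem IsTestField.le_toReal_totalVar (hX : IsTestField D X) {f : Plane → ℝ}
    (hf : totalVar D f < ⊤) : ∫ x in D, f x * divergence X x ≤ (totalVar D f).toReal :=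
  (ENNReal.ofReal_le_iff_le_toReal hf.ne).1 (hX.le_totalVar f)

theorem totalVar_le {f : Plane → ℝ} {C : ℝ}
    (h : ∀ X, IsTestField D X → ∫ x in D, f x * divergence X x ≤ C) :
    totalVar D f ≤ ENNReal.ofReal C := by
  unfold totalVar
  refine iSup_le fun X => iSup_le fun h1 => iSup_le fun h2 => iSup_le fun h3 => iSup_le fun h4 => ?_
  exact ENNReal.ofReal_le_ofReal (h X ⟨h1, h2, h3, h4⟩)

theorem abs_coord_le (v : Plane) (i : Fin 2) : |v i| ≤ ‖v‖ := by
  simpa using PiLp.norm_apply_le v i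

theorem norm_single_one (i : Fin 2) : ‖(EuclideanSpace.single i 1 : Plane)‖ = 1 := by
  simp

theorem abs_divergence_le (X : Plane → Plane) (x : Plane) :
    |divergence X x| ≤ 2 * ‖fderiv ℝ X x‖ := by
  have h : ∀ i : Fin 2, |fderiv ℝ X x (EuclideanSpace.single i 1) i| ≤ ‖fderiv ℝ X x‖ := fun i =>
    (abs_coord_le _ i).trans <| by
      simpa using (fderiv ℝ X x).le_opNorm (EuclideanSpace.single i 1)
  rw [divergence, Fin.sum_univ_two]
  refine (abs_add_le _ _).trans ?_
  linarith [h 0, h 1]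

theorem IsTestField.continuous_divergence (hX : IsTestField D X) :
    Continuous (divergence X) := by
  have h := hX.contDiff.continuous_fderiv one_ne_zero
  unfold divergence
  refine continuous_finsetSum _ fun i _ => ?_
  exact (EuclideanSpace.proj (𝕜 := ℝ) i).continuous.comp (h.clm_apply continuous_const)

theorem divergence_eq_zero {x : Plane} (hx : x ∉ tsupport X) :
    divergence X x = 0 := by
  simp [divergence, fderiv_of_notMem_tsupport ℝ hx]

theorem IsTestField.exists_abs_divergence_le (hX : IsTestField D X) :
    ∃ C, 0 ≤ C ∧ ∀ x, |divergence X x| ≤ C := by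
  have hc : HasCompactSupport (divergence X) :=
    HasCompactSupport.intro hX.hasCompactSupport fun x hx => divergence_eq_zero hx
  obtain ⟨C, hC⟩ := hc.exists_bound_of_continuous hX.continuous_divergence
  exact ⟨C, (norm_nonneg _).trans (hC 0), hC⟩

theorem plane_eq_sum (v : Plane) : v = ∑ i, v i • (EuclideanSpace.single i 1 : Plane) := by
  ext j
  fin_cases j <;> simp

/-- Integration by parts against a test field. -/
theorem IsTestField.integral_mul_divergence (hX : IsTestField D X) {f : Plane → ℝ}
    (hf : ContDiff ℝ 1 f) :
    ∫ x in D, f x * divergence X x = -∫ x in D, fderiv ℝ f x (X x) := by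
  have hXd : Differentiable ℝ X := hX.contDiff.differentiable one_ne_zero
  have hfd : Differentiable ℝ f := hf.differentiable one_ne_zero
  have hX' := hX.contDiff.continuous_fderiv one_ne_zero
  have hf' := hf.continuous_fderiv one_ne_zero
  have zero : ∀ x, x ∉ D → X x = 0 ∧ divergence X x = 0 := fun x hx => by
    have := fun h => hx (hX.tsupport_subset h)
    exact ⟨image_eq_zero_of_notMem_tsupport this, divergence_eq_zero this⟩
  rw [setIntegral_eq_integral_of_forall_compl_eq_zero fun x hx => by rw [(zero x hx).2, mul_zero],
    setIntegral_eq_integral_of_forall_compl_eq_zero fun x hx => by rw [(zero x hx).1, map_zero]]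
  have coord : ∀ (i : Fin 2) (x v : Plane),
      fderiv ℝ (fun y => X y i) x v = fderiv ℝ X x v i := fun i x v => by
    have := ((EuclideanSpace.proj (𝕜 := ℝ) i).hasFDerivAt.comp x (hXd x).hasFDerivAt).fderiv
    change fderiv ℝ ((EuclideanSpace.proj (𝕜 := ℝ) i) ∘ X) x v = _
    rw [this]
    rfl
  have hci : ∀ i : Fin 2, Continuous fun x => X x i := fun i =>
    (EuclideanSpace.proj (𝕜 := ℝ) i).continuous.comp hX.contDiff.continuous
  have hdi : ∀ i : Fin 2, Continuous fun x => fderiv ℝ X x (EuclideanSpace.single i 1) i :=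
    fun i => (EuclideanSpace.proj (𝕜 := ℝ) i).continuous.comp (hX'.clm_apply continuous_const)
  have int : ∀ k : Plane → ℝ, Continuous k → (∀ x, x ∉ tsupport X → k x = 0) → Integrable k :=
    fun k hk h0 => hk.integrable_of_hasCompactSupport
      (HasCompactSupport.intro hX.hasCompactSupport h0)
  have i1 : ∀ i : Fin 2,
      Integrable fun x => f x * fderiv ℝ X x (EuclideanSpace.single i 1) i := fun i =>
    int _ (hf.continuous.mul (hdi i)) fun x hx => by simp [fderiv_of_notMem_tsupport ℝ hx]
  have i2 : ∀ i : Fin 2,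
      Integrable fun x => fderiv ℝ f x (EuclideanSpace.single i 1) * X x i := fun i =>
    int _ ((hf'.clm_apply continuous_const).mul (hci i)) fun x hx => by
      simp [image_eq_zero_of_notMem_tsupport hx]
  have parts : ∀ i : Fin 2, ∫ x, f x * fderiv ℝ X x (EuclideanSpace.single i 1) i
      = -∫ x, fderiv ℝ f x (EuclideanSpace.single i 1) * X x i := fun i => by
    have := integral_mul_fderiv_eq_neg_fderiv_mul_of_integrable (μ := (volume : Measure Plane))
      (f := f) (g := fun x => X x i) (v := EuclideanSpace.single i 1) (i2 i)
      (by simpa only [coord] using i1 i)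
      (int _ (hf.continuous.mul (hci i)) fun x hx => by
        simp [image_eq_zero_of_notMem_tsupport hx])
      (fun x _ => hfd x) (fun x _ => (EuclideanSpace.proj (𝕜 := ℝ) i).differentiableAt.comp x
        (hXd x))
    simpa only [coord] using this
  have e1 : ∀ x, f x * divergence X x
      = ∑ i, f x * fderiv ℝ X x (EuclideanSpace.single i 1) i := fun x => by
    rw [divergence, Finset.mul_sum]
  have e2 : ∀ x, fderiv ℝ f x (X x)
      = ∑ i, fderiv ℝ f x (EuclideanSpace.single i 1) * X x i := fun x => by
    conv_lhs => rw [plane_eq_sum (X x)]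
    simp [mul_comm]
  simp_rw [e1, e2]
  rw [integral_finsetSum _ fun i _ => i1 i, integral_finsetSum _ fun i _ => i2 i,
    ← Finset.sum_neg_distrib]
  exact Finset.sum_congr rfl fun i _ => parts i

theorem integrableOn_ball_of_continuous {E : Type*} [NormedAddCommGroup E] {k : Plane → E}
    (hk : Continuous k) (r : ℝ) : IntegrableOn k (Metric.ball 0 r) :=
  (hk.continuousOn.integrableOn_compact (isCompact_closedBall 0 r)).mono_set
    Metric.ball_subset_closedBall

/-- Integration by parts and `‖X‖ ≤ 1`. Only this inequality is needed: aligned fields supply the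
converse up to `1 - ε`. -/
theorem totalVar_ball_le {f : Plane → ℝ} (hf : ContDiff ℝ 1 f) (r : ℝ) :
    totalVar (Metric.ball 0 r) f
      ≤ ENNReal.ofReal (∫ x in Metric.ball (0 : Plane) r, ‖fderiv ℝ f x‖) := by
  refine totalVar_le fun X hX => ?_
  have hf' := hf.continuous_fderiv one_ne_zero
  rw [hX.integral_mul_divergence hf, ← integral_neg]
  refine integral_mono (integrableOn_ball_of_continuous
    (hf'.clm_apply hX.contDiff.continuous).neg r) (integrableOn_ball_of_continuous hf'.norm r)
    fun x => ?_
  refine (neg_le_abs _).trans (((fderiv ℝ f x).le_opNorm _).trans ?_)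
  exact mul_le_of_le_one_right (norm_nonneg _) (hX.norm_le x)

theorem isBV_ball_of_contDiff {f : Plane → ℝ} (hf : ContDiff ℝ 1 f) (r : ℝ) :
    IsBV (Metric.ball 0 r) f :=
  ⟨integrableOn_ball_of_continuous hf.continuous r,
    (totalVar_ball_le hf r).trans_lt ENNReal.ofReal_lt_top⟩

end TotalVariation

/-! ### A test field almost aligned with the gradient -/

section AlignedField

variable {α : ℝ≥0}

/-- The vector of the difference quotients of step `t`. -/
noncomputable def diffQuot (I : Plane → ℝ) (t : ℝ) (x : Plane) : Plane :=
  ∑ i : Fin 2, ((I (x + t • EuclideanSpace.single i 1) - I x) / t) •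
    (EuclideanSpace.single i 1 : Plane)

theorem contDiff_diffQuot {I : Plane → ℝ} (hI : ContDiff ℝ 1 I) (t : ℝ) :
    ContDiff ℝ 1 (diffQuot I t) := by
  unfold diffQuot
  refine ContDiff.sum fun i _ => ContDiff.fun_smul ?_ contDiff_const
  exact ((hI.comp (by fun_prop)).sub hI).div_const t

theorem norm_sum_smul_single_le {C : ℝ} (c : Fin 2 → ℝ) (hc : ∀ i, |c i| ≤ C) :
    ‖∑ i, c i • (EuclideanSpace.single i 1 : Plane)‖ ≤ 2 * C := by
  rw [Fin.sum_univ_two]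
  refine (norm_add_le _ _).trans ?_
  rw [norm_smul, norm_smul, norm_single_one, norm_single_one, Real.norm_eq_abs, Real.norm_eq_abs]
  linarith [hc 0, hc 1]

/-- The gradient of `I` need not be differentiable, so the step `t` is kept positive. The bound
degenerates as `t → 0` but depends on `I` only through `M`. -/
theorem norm_fderiv_diffQuot_le {I : Plane → ℝ} (hI : ContDiff ℝ 1 I) {t M r : ℝ} (ht : 0 < t)
    (hM : ∀ x ∈ Metric.ball (0 : Plane) (r + t), ‖fderiv ℝ I x‖ ≤ M) {x : Plane}
    (hx : x ∈ Metric.ball (0 : Plane) r) : ‖fderiv ℝ (diffQuot I t) x‖ ≤ 4 * M / t := by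
  have hd : Differentiable ℝ I := hI.differentiable one_ne_zero
  have hx0 : ‖x‖ < r := by simpa using hx
  have step : ∀ i : Fin 2, x + t • (EuclideanSpace.single i 1 : Plane) ∈
      Metric.ball (0 : Plane) (r + t) := fun i => by
    rw [mem_ball_zero_iff]
    refine (norm_add_le _ _).trans_lt ?_
    rw [norm_smul, norm_single_one, Real.norm_of_nonneg ht.le]
    linarith
  set A : Fin 2 → Plane →L[ℝ] ℝ := fun i =>
    t⁻¹ • (fderiv ℝ I (x + t • EuclideanSpace.single i 1) - fderiv ℝ I x) with hA
  have hder : HasFDerivAt (diffQuot I t)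
      (∑ i : Fin 2, (A i).smulRight (EuclideanSpace.single i 1 : Plane)) x := by
    unfold diffQuot
    refine HasFDerivAt.fun_sum fun i _ => ?_
    have h1 : HasFDerivAt (fun y => I (y + t • EuclideanSpace.single i 1))
        (fderiv ℝ I (x + t • EuclideanSpace.single i 1)) x :=
      (hasFDerivAt_comp_add_right _).2 (hd _).hasFDerivAt
    have h2 := ((h1.sub (hd x).hasFDerivAt).const_smul t⁻¹).smul_const
      (EuclideanSpace.single i 1 : Plane)
    refine h2.congr_of_eventuallyEq (Eventually.of_forall fun y => ?_)
    simp only [Pi.sub_apply, Pi.smul_apply, smul_eq_mul, div_eq_inv_mul]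
  have hAn : ∀ i, ‖A i‖ ≤ 2 * M / t := fun i => by
    rw [hA, norm_smul, norm_inv, Real.norm_of_nonneg ht.le, ← div_eq_inv_mul]
    gcongr
    refine (norm_sub_le _ _).trans ?_
    have h0 : x ∈ Metric.ball (0 : Plane) (r + t) := by
      rw [mem_ball_zero_iff]
      linarith
    linarith [hM _ (step i), hM _ h0]
  rw [hder.fderiv, Fin.sum_univ_two]
  refine (norm_add_le _ _).trans ?_
  rw [ContinuousLinearMap.norm_smulRight_apply, ContinuousLinearMap.norm_smulRight_apply,
    norm_single_one, norm_single_one]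
  have h0 := hAn 0
  have h1 := hAn 1
  have e : 4 * M / t = 2 * M / t + 2 * M / t := by ring
  linarith

/-- Each quotient differs from the partial derivative by at most the oscillation of `DI` at distance
`t`, namely `M t^α`. -/
theorem norm_diffQuot_sub_gradient_le {I : Plane → ℝ} (hI : Differentiable ℝ I) {t M r : ℝ}
    (ht : 0 < t) (hM : 0 ≤ M) (hb : C1aBound α M (Metric.ball 0 (r + 2 * t)) I) {x : Plane}
    (hx : x ∈ Metric.ball (0 : Plane) r) :
    ‖diffQuot I t x - gradient I x‖ ≤ 2 * (M * t ^ (α : ℝ)) := by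
  have hx0 : ‖x‖ < r := by simpa using hx
  have hcoord : ∀ i : Fin 2, gradient I x i = fderiv ℝ I x (EuclideanSpace.single i 1) := fun i => by
    have : inner ℝ (gradient I x) (EuclideanSpace.single i 1 : Plane)
        = fderiv ℝ I x (EuclideanSpace.single i 1) := by
      rw [gradient, InnerProductSpace.toDual_symm_apply]
    rw [← this, EuclideanSpace.inner_single_right]
    simp
  have e : diffQuot I t x - gradient I x = ∑ i : Fin 2,
      ((I (x + t • EuclideanSpace.single i 1) - I x) / t
        - fderiv ℝ I x (EuclideanSpace.single i 1)) • (EuclideanSpace.single i 1 : Plane) := by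
    conv_lhs => rw [plane_eq_sum (gradient I x)]
    rw [diffQuot, ← Finset.sum_sub_distrib]
    simp_rw [hcoord, ← sub_smul]
  rw [e]
  refine norm_sum_smul_single_le _ fun i => ?_
  have hin : ∀ z ∈ Metric.closedBall x t, z ∈ Metric.ball (0 : Plane) (r + 2 * t) := fun z hz => by
    rw [mem_ball_zero_iff]
    rw [mem_closedBall_iff_norm] at hz
    linarith [norm_sub_norm_le z x]
  have hx' := hin x (Metric.mem_closedBall_self ht.le)
  have hstep : ‖x + t • (EuclideanSpace.single i 1 : Plane) - x‖ = t := by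
    rw [add_sub_cancel_left, norm_smul, norm_single_one, mul_one, Real.norm_of_nonneg ht.le]
  have h := (convex_closedBall x t).norm_image_sub_le_of_norm_fderiv_le'
    (f := I) (φ := fderiv ℝ I x) (C := M * t ^ (α : ℝ)) (fun z _ => hI z)
    (fun z hz => (hb.hol z (hin z hz) x hx').trans (by
      gcongr
      rwa [mem_closedBall_iff_norm] at hz))
    (Metric.mem_closedBall_self ht.le)
    (show x + t • (EuclideanSpace.single i 1 : Plane) ∈ Metric.closedBall x t by
      rw [mem_closedBall_iff_norm, hstep])
  rw [hstep, add_sub_cancel_left, map_smul, smul_eq_mul, Real.norm_eq_abs] at h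
  have e2 : (I (x + t • EuclideanSpace.single i 1) - I x) / t
        - fderiv ℝ I x (EuclideanSpace.single i 1)
      = (I (x + t • EuclideanSpace.single i 1) - I x
        - t * fderiv ℝ I x (EuclideanSpace.single i 1)) / t := by
    field_simp
  rw [e2, abs_div, abs_of_pos ht, div_le_iff₀ ht]
  exact h

/-- The regularized normalization `v ↦ v / √(|v|² + κ²)`. -/
noncomputable def softNormalize (κ : ℝ) (v : Plane) : Plane :=
  (√(‖v‖ ^ 2 + κ ^ 2))⁻¹ • v

theorem sqrt_pos_of_pos {κ : ℝ} (hκ : 0 < κ) (v : Plane) : 0 < √(‖v‖ ^ 2 + κ ^ 2) :=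
  Real.sqrt_pos.2 (by positivity)

theorem contDiff_softNormalize {κ : ℝ} (hκ : 0 < κ) : ContDiff ℝ 1 (softNormalize κ) := by
  unfold softNormalize
  refine ContDiff.smul (ContDiff.inv (ContDiff.sqrt ?_ fun v => ?_) fun v => ?_) contDiff_id
  · exact (contDiff_norm_sq ℝ).add contDiff_const
  · positivity
  · exact (sqrt_pos_of_pos hκ v).ne'

theorem norm_softNormalize_le {κ : ℝ} (hκ : 0 < κ) (v : Plane) : ‖softNormalize κ v‖ ≤ 1 := by
  have h := sqrt_pos_of_pos hκ v
  rw [softNormalize, norm_smul, norm_inv, Real.norm_of_nonneg h.le, ← div_eq_inv_mul, div_le_one h]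
  exact Real.le_sqrt_of_sq_le (by nlinarith)

/-- One has `l v ≥ ‖l‖(‖l‖ - τ)`, while the normalizing root is at most `‖l‖ + τ + κ`. The quotient
is at least `(1 - ε)‖l‖` because `2τ + κ ≤ εc ≤ ε‖l‖`. -/
theorem softNormalize_aligned {κ τ c ε : ℝ} (hκ : 0 < κ) (hτ : 0 ≤ τ) (hε1 : ε ≤ 1)
    (hε : 2 * τ + κ ≤ ε * c) {l : Plane →L[ℝ] ℝ} {g v : Plane}
    (hg : ∀ w, l w = inner ℝ g w) (hgn : ‖g‖ = ‖l‖) (hc : c ≤ ‖l‖) (hε0 : 0 ≤ ε)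
    (hv : ‖v - g‖ ≤ τ) :
    (1 - ε) * ‖l‖ ≤ l (softNormalize κ v) := by
  have hS := sqrt_pos_of_pos hκ v
  have hSle : √(‖v‖ ^ 2 + κ ^ 2) ≤ ‖l‖ + τ + κ := by
    have hv2 : ‖v‖ ≤ ‖l‖ + τ := by linarith [norm_sub_norm_le v g]
    rw [Real.sqrt_le_left (by positivity)]
    nlinarith [norm_nonneg v, norm_nonneg l]
  have hlv : ‖l‖ * (‖l‖ - τ) ≤ l v := by
    have h1 : l v = ‖l‖ ^ 2 + l (v - g) := by
      rw [map_sub, hg g, real_inner_self_eq_norm_sq, hgn]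
      ring
    have h2 := (abs_le.1 ((l.le_opNorm (v - g)).trans
      (mul_le_mul_of_nonneg_left hv (norm_nonneg l)))).1
    rw [h1]
    linarith
  rw [softNormalize, map_smul, smul_eq_mul, ← div_eq_inv_mul, le_div_iff₀ hS]
  have h3 : (1 - ε) * (‖l‖ + τ + κ) ≤ ‖l‖ - τ := by nlinarith [mul_le_mul_of_nonneg_left hc hε0]
  calc (1 - ε) * ‖l‖ * √(‖v‖ ^ 2 + κ ^ 2) ≤ (1 - ε) * ‖l‖ * (‖l‖ + τ + κ) := by
        gcongr
    _ = ‖l‖ * ((1 - ε) * (‖l‖ + τ + κ)) := by ring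
    _ ≤ ‖l‖ * (‖l‖ - τ) := by gcongr
    _ ≤ l v := hlv

/-- Test fields with uniformly bounded divergence that are almost aligned with `-∇I` where the
gradient is not small. -/
theorem exists_alignedField (hα0 : 0 < α) {M R₁ c ε : ℝ} (hM : 0 ≤ M) (hR₁ : 0 < R₁) (hc : 0 < c)
    (hε0 : 0 < ε) (hε1 : ε ≤ 1) :
    ∃ C, 0 ≤ C ∧ ∀ I : Plane → ℝ, ContDiff ℝ 1 I → C1aBound α M (Metric.ball 0 (R₁ + 2)) I →
      ∃ X, IsTestField (Metric.ball 0 (R₁ + 1)) X ∧ (∀ x, |divergence X x| ≤ C) ∧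
        ∀ x ∈ Metric.ball (0 : Plane) R₁, c ≤ ‖fderiv ℝ I x‖ →
          (1 - ε) * ‖fderiv ℝ I x‖ ≤ -(fderiv ℝ I x (X x)) := by
  have hα : (0 : ℝ) < α := by exact_mod_cast hα0
  -- The approximation error is made at most `τ = εc/4`; with `κ = εc/2` this gives exactly `2τ + κ
  -- = εc`. The bound `t ≤ 1/2` keeps all evaluations inside the ball of radius `R₁ + 2`.
  obtain ⟨t, ht, ht1, htτ⟩ : ∃ t : ℝ, 0 < t ∧ t ≤ 1 / 2 ∧ 2 * (M * t ^ (α : ℝ)) ≤ ε * c / 4 := by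
    have h : Tendsto (fun t : ℝ => 2 * (M * t ^ (α : ℝ))) (𝓝[>] 0) (𝓝 0) := by
      have : ContinuousAt (fun t : ℝ => 2 * (M * t ^ (α : ℝ))) 0 :=
        continuousAt_const.mul (continuousAt_const.mul
          (continuousAt_id.rpow_const (Or.inr hα.le)))
      have h' := this.tendsto.mono_left (nhdsWithin_le_nhds (s := Ioi 0))
      simpa [Real.zero_rpow hα.ne'] using h'
    have h1 := h.eventually_le_const (show (0 : ℝ) < ε * c / 4 by positivity)
    have h2 : ∀ᶠ t : ℝ in 𝓝[>] 0, t ≤ 1 / 2 :=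
      nhdsWithin_le_nhds (eventually_le_nhds (by norm_num))
    obtain ⟨t, ⟨a1, a2⟩, a3⟩ := ((eventually_mem_nhdsWithin.and h2).and h1).exists
    exact ⟨t, a1, a2, a3⟩
  set κ : ℝ := ε * c / 2 with hκdef
  have hκ : 0 < κ := by positivity
  -- The difference quotients take their values in this ball, so the derivative of the normalization
  -- is bounded there independently of `I`.
  set B : ℝ := M + ε * c / 4 with hB
  obtain ⟨CN, hCN⟩ := (isCompact_closedBall (0 : Plane) B).exists_bound_of_continuousOn
    ((contDiff_softNormalize hκ).continuous_fderiv one_ne_zero).continuousOn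
  have hCN0 : 0 ≤ CN := (norm_nonneg _).trans
    (hCN 0 (Metric.mem_closedBall_self (by positivity)))
  let χ : ContDiffBump (0 : Plane) := ⟨R₁, R₁ + 1 / 2, hR₁, by linarith⟩
  have hχ : ContDiff ℝ 1 χ := χ.contDiff
  obtain ⟨Cχ, hCχ⟩ := (χ.hasCompactSupport.fderiv (𝕜 := ℝ)).exists_bound_of_continuous
    (hχ.continuous_fderiv one_ne_zero)
  have hCχ0 : 0 ≤ Cχ := (norm_nonneg _).trans (hCχ 0)
  refine ⟨2 * (CN * (4 * M / t) + Cχ), by positivity, fun I hI hb => ?_⟩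
  have hId : Differentiable ℝ I := hI.differentiable one_ne_zero
  have hb2 : C1aBound α M (Metric.ball 0 (R₁ + 1 + 2 * t)) I :=
    hb.mono le_rfl (Metric.ball_subset_ball (by linarith))
  have happrox : ∀ x ∈ Metric.ball (0 : Plane) (R₁ + 1),
      ‖diffQuot I t x - gradient I x‖ ≤ ε * c / 4 := fun x hx =>
    (norm_diffQuot_sub_gradient_le hId ht hM hb2 hx).trans htτ
  have hN : ContDiff ℝ 1 fun x => softNormalize κ (diffQuot I t x) :=
    (contDiff_softNormalize hκ).comp (contDiff_diffQuot hI t)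
  have hsub : tsupport (fun x => -(χ x • softNormalize κ (diffQuot I t x))) ⊆ tsupport χ := by
    refine closure_mono fun x hx => ?_
    rw [Function.mem_support] at hx ⊢
    intro h0
    exact hx (by rw [h0, zero_smul, neg_zero])
  have hχB : tsupport χ ⊆ Metric.ball (0 : Plane) (R₁ + 1) := by
    rw [χ.tsupport_eq]
    exact Metric.closedBall_subset_ball (by change R₁ + 1 / 2 < R₁ + 1; linarith)
  -- The sign compensates the one produced by integration by parts.
  refine ⟨fun x => -(χ x • softNormalize κ (diffQuot I t x)), ⟨(hχ.smul hN).neg, ?_,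
    hsub.trans hχB, fun x => ?_⟩, fun x => ?_, fun x hx hcx => ?_⟩
  · exact IsCompact.of_isClosed_subset χ.hasCompactSupport isClosed_closure hsub
  · rw [norm_neg, norm_smul, Real.norm_of_nonneg χ.nonneg]
    exact mul_le_one₀ χ.le_one (norm_nonneg _) (norm_softNormalize_le hκ _)
  · by_cases hx : x ∈ Metric.ball (0 : Plane) (R₁ + 1)
    · refine (abs_divergence_le _ x).trans (mul_le_mul_of_nonneg_left ?_ zero_le_two)
      have hNd : HasFDerivAt (fun x => softNormalize κ (diffQuot I t x))
          ((fderiv ℝ (softNormalize κ) (diffQuot I t x)).comp (fderiv ℝ (diffQuot I t) x)) x :=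
        ((contDiff_softNormalize hκ).differentiable one_ne_zero _).hasFDerivAt.comp x
          ((contDiff_diffQuot hI t).differentiable one_ne_zero x).hasFDerivAt
      have hXd := ((hχ.differentiable one_ne_zero x).hasFDerivAt.smul hNd).neg
      have hXd' : fderiv ℝ (fun x => -(χ x • softNormalize κ (diffQuot I t x))) x = _ := hXd.fderiv
      rw [hXd', norm_neg]
      refine (norm_add_le _ _).trans (add_le_add ?_ ?_)
      · rw [norm_smul, Real.norm_of_nonneg χ.nonneg]
        refine (mul_le_of_le_one_left (norm_nonneg _) χ.le_one).trans ?_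
        refine (ContinuousLinearMap.opNorm_comp_le _ _).trans ?_
        refine mul_le_mul (hCN _ ?_) ?_ (norm_nonneg _) hCN0
        · rw [mem_closedBall_zero_iff]
          have h1 := happrox x hx
          have h2 := norm_sub_norm_le (diffQuot I t x) (gradient I x)
          have h3 := hb.der x (Metric.ball_subset_ball (by linarith) hx)
          rw [← norm_gradient_eq] at h3
          linarith
        · exact norm_fderiv_diffQuot_le hI ht
            (fun y hy => hb.der y (Metric.ball_subset_ball (by linarith) hy)) hx
      · rw [ContinuousLinearMap.norm_smulRight_apply]
        exact (mul_le_of_le_one_right (norm_nonneg _) (norm_softNormalize_le hκ _)).trans (hCχ x)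
    · rw [divergence_eq_zero fun h => hx (hχB (hsub h)), abs_zero]
      positivity
  · have h1 : χ x = 1 := χ.one_of_mem_closedBall (Metric.ball_subset_closedBall hx)
    simp only [h1, one_smul, map_neg, neg_neg]
    refine softNormalize_aligned (g := gradient I x) (τ := ε * c / 4) (c := c) hκ (by positivity)
      hε1 ?_ (fun w => ?_) (norm_gradient_eq I x) hcx hε0.le
      (happrox x (Metric.ball_subset_ball (by linarith) hx))
    · rw [hκdef]
      linarith
    · rw [gradient, InnerProductSpace.toDual_symm_apply]

end AlignedField

/-! ### Sharp and smooth thresholds of a function with a nondegenerate level set -/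

section Levels

variable {α : ℝ≥0} {M R₁ h δ c : ℝ} {φ : ℝ → ℝ} {I : Plane → ℝ}

/-- Near the level `h`, the function `I` is `C^{1,α}`, its level sets are bounded and its gradient
does not vanish, with uniform constants. -/
structure IsRegularNear (α : ℝ≥0) (M R₁ h δ c : ℝ) (I : Plane → ℝ) : Prop where
  contDiff : ContDiff ℝ 1 I
  bound : C1aBound α M (Metric.ball 0 (R₁ + 2)) I
  enclosed : ∀ x, h - δ < I x → x ∈ Metric.ball (0 : Plane) R₁
  gradient_ge : ∀ x, |I x - h| ≤ δ → c ≤ ‖fderiv ℝ I x‖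

/-- The part of the domain where `I` is within `η` of the level `h`. -/
def levelBand (R₁ h η : ℝ) (I : Plane → ℝ) : Set Plane :=
  Metric.ball 0 (R₁ + 1) ∩ {x | |I x - h| ≤ η}

theorem measurableSet_levelBand (hI : Continuous I) (η : ℝ) :
    MeasurableSet (levelBand R₁ h η I) :=
  measurableSet_ball.inter (isClosed_le (by fun_prop) continuous_const).measurableSet

theorem levelBand_ne_top (η : ℝ) : volume (levelBand R₁ h η I) ≠ ⊤ :=
  ((measure_mono inter_subset_left).trans_lt measure_ball_lt_top).ne

/-- The field `X` is a test field with divergence bounded by `C`, which almost realizes the total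
variation of the functions of `I` concentrated near the level `h`. -/
structure IsAligned (R₁ h δ ε C : ℝ) (I : Plane → ℝ) (X : Plane → Plane) : Prop where
  testField : IsTestField (Metric.ball 0 (R₁ + 1)) X
  div_le : ∀ x, |divergence X x| ≤ C
  aligned : ∀ x, |I x - h| < δ → (1 - ε) * ‖fderiv ℝ I x‖ ≤ -(fderiv ℝ I x (X x))

theorem exists_isAligned (hα0 : 0 < α) (hM : 0 ≤ M) (hR₁ : 0 < R₁) (hc : 0 < c) (h δ : ℝ) {ε : ℝ}
    (hε0 : 0 < ε) (hε1 : ε ≤ 1) :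
    ∃ C, 0 ≤ C ∧ ∀ I, IsRegularNear α M R₁ h δ c I → ∃ X, IsAligned R₁ h δ ε C I X := by
  obtain ⟨C, hC, H⟩ := exists_alignedField hα0 hM hR₁ hc hε0 hε1
  refine ⟨C, hC, fun I hI => ?_⟩
  obtain ⟨X, h1, h2, h3⟩ := H I hI.contDiff hI.bound
  refine ⟨X, h1, h2, fun x hx => h3 x (hI.enclosed x ?_) (hI.gradient_ge x hx.le)⟩
  linarith [(abs_lt.1 hx).1]

/-- The derivative of `θ ∘ I` is `θ'(I) DI` with `θ' ≥ 0`. It vanishes where `|I - h| ≥ δ`, and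
elsewhere `X` is aligned, so the inequality holds pointwise after integration by parts. -/
theorem IsAligned.le_integral {ε C : ℝ} {X : Plane → Plane} (hX : IsAligned R₁ h δ ε C I X)
    (hI : ContDiff ℝ 1 I) {θ : ℝ → ℝ} (hθ : ContDiff ℝ 1 θ) (hθ_nonneg : ∀ t, 0 ≤ deriv θ t)
    (hθ_zero : ∀ t, δ ≤ |t - h| → deriv θ t = 0) :
    (1 - ε) * ∫ x in Metric.ball (0 : Plane) (R₁ + 1), ‖fderiv ℝ (fun x => θ (I x)) x‖
      ≤ ∫ x in Metric.ball (0 : Plane) (R₁ + 1), θ (I x) * divergence X x := by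
  have hc : ContDiff ℝ 1 fun x => θ (I x) := hθ.comp hI
  have hc' := hc.continuous_fderiv one_ne_zero
  rw [hX.testField.integral_mul_divergence hc, ← integral_neg, ← integral_const_mul]
  refine integral_mono (integrableOn_ball_of_continuous (continuous_const.mul hc'.norm) _)
    (integrableOn_ball_of_continuous (hc'.clm_apply hX.testField.contDiff.continuous).neg _)
    fun x => ?_
  simp only
  rw [fderiv_comp_real (hθ.differentiable one_ne_zero) (hI.differentiable one_ne_zero), norm_smul,
    Real.norm_of_nonneg (hθ_nonneg _), smul_apply, smul_eq_mul]
  by_cases hx : |I x - h| < δ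
  · have := mul_le_mul_of_nonneg_left (hX.aligned x hx) (hθ_nonneg (I x))
    linarith
  · rw [hθ_zero _ (not_lt.1 hx)]
    simp

theorem IsAligned.integral_le {ε C B : ℝ} {X : Plane → Plane} (hX : IsAligned R₁ h δ ε C I X)
    {g : Plane → ℝ} (hg : ∀ x, |g x| ≤ B) :
    ∫ x in Metric.ball (0 : Plane) (R₁ + 1), g x * divergence X x
      ≤ B * C * volume.real (Metric.ball (0 : Plane) (R₁ + 1)) := by
  refine (le_abs_self _).trans ?_
  rw [← Real.norm_eq_abs]
  refine norm_setIntegral_le_of_norm_le_const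
    (measure_ball_lt_top (μ := (volume : Measure Plane))) fun x _ => ?_
  rw [norm_mul]
  exact mul_le_mul (hg x) (hX.div_le x) (norm_nonneg _) ((abs_nonneg _).trans (hg x))

/-- A bounded increasing `C¹` function whose derivative is at least one on `[-1,1]` and vanishes
outside `[-2,2]`. -/
theorem exists_bounded_transition : ∃ (θ : ℝ → ℝ) (B : ℝ), ContDiff ℝ 1 θ ∧ (∀ t, |θ t| ≤ B) ∧
    (∀ t, 0 ≤ deriv θ t) ∧ (∀ t, |t| ≤ 1 → 1 ≤ deriv θ t) ∧ ∀ t, 2 ≤ |t| → deriv θ t = 0 := by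
  set k : ℝ → ℝ := fun t => max 0 (2 - |t|) with hk
  have hkc : Continuous k := by fun_prop
  have hint : Integrable k := hkc.integrable_of_hasCompactSupport <|
    HasCompactSupport.intro (isCompact_Icc (a := -2) (b := 2)) fun t ht => by
      have : 2 ≤ |t| := by
        by_contra hlt
        exact ht (abs_le.1 (not_le.1 hlt).le)
      simp only [hk]
      exact max_eq_left (by linarith)
  have hd : ∀ t, HasDerivAt (fun t => ∫ s in (0 : ℝ)..t, k s) (k t) t := fun t =>
    intervalIntegral.integral_hasDerivAt_right (hkc.intervalIntegrable _ _)
      (hkc.stronglyMeasurableAtFilter _ _) hkc.continuousAt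
  have hd' : deriv (fun t => ∫ s in (0 : ℝ)..t, k s) = k := funext fun t => (hd t).deriv
  refine ⟨fun t => ∫ s in (0 : ℝ)..t, k s, ∫ s, ‖k s‖, ?_, fun t => ?_, fun t => ?_,
    fun t ht => ?_, fun t ht => ?_⟩
  · rw [contDiff_one_iff_deriv, hd']
    exact ⟨fun t => (hd t).differentiableAt, hkc⟩
  · rw [← Real.norm_eq_abs]
    refine intervalIntegral.norm_integral_le_integral_norm_uIoc.trans ?_
    exact setIntegral_le_integral hint.norm (Eventually.of_forall fun _ => norm_nonneg _)
  · rw [hd']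
    exact le_max_left _ _
  · rw [hd']
    exact le_max_of_le_right (by linarith)
  · rw [hd']
    exact max_eq_left (by linarith)

theorem hasDerivAt_rescale {θ : ℝ → ℝ} (hθ : Differentiable ℝ θ) (h η t : ℝ) :
    HasDerivAt (fun t => θ ((t - h) / η)) (deriv θ ((t - h) / η) * (1 / η)) t :=
  (hθ _).hasDerivAt.comp t (((hasDerivAt_id t).sub_const h).div_const η)

theorem contDiff_rescale {θ : ℝ → ℝ} (hθ : ContDiff ℝ 1 θ) (h η : ℝ) :
    ContDiff ℝ 1 (fun t => θ ((t - h) / η)) :=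
  hθ.comp (by fun_prop)

/-- Take a bounded increasing transition of width `η`. Its composition with `I` has gradient at
least `c/η` on the band, while testing with a field aligned for `ε = 1/2` bounds the integral of
that gradient independently of `η`. -/
theorem exists_volume_levelBand_le (hα0 : 0 < α) (hM : 0 ≤ M) (hR₁ : 0 < R₁) (hc : 0 < c)
    (h δ : ℝ) :
    ∃ m, 0 ≤ m ∧ ∀ I, IsRegularNear α M R₁ h δ c I → ∀ η, 0 < η → η ≤ δ / 2 →
      volume.real (levelBand R₁ h η I) ≤ m * η := by
  obtain ⟨C, hC, H⟩ := exists_isAligned (ε := 1 / 2) hα0 hM hR₁ hc h δ (by norm_num) (by norm_num)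
  obtain ⟨θ, B, hθ, hB, hθ0, hθ1, hθ2⟩ := exists_bounded_transition
  have hB0 : 0 ≤ B := (abs_nonneg _).trans (hB 0)
  set V := volume.real (Metric.ball (0 : Plane) (R₁ + 1))
  have hV : 0 ≤ V := measureReal_nonneg
  refine ⟨2 * (B * C * V) / c, by positivity, fun I hI η hη hηδ => ?_⟩
  obtain ⟨X, hX⟩ := H I hI
  have hder : ∀ t, deriv (fun t => θ ((t - h) / η)) t = deriv θ ((t - h) / η) * (1 / η) := fun t =>
    (hasDerivAt_rescale (hθ.differentiable one_ne_zero) h η t).deriv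
  have h1 := hX.le_integral hI.contDiff (contDiff_rescale hθ h η)
    (fun t => by
      rw [hder]
      exact mul_nonneg (hθ0 _) (by positivity))
    -- The derivative of the transition lives on `|t - h| ≤ 2η`, hence the requirement `η ≤ δ/2`.
    (fun t ht => by
      rw [hder, hθ2, zero_mul]
      rw [abs_div, abs_of_pos hη, le_div_iff₀ hη]
      linarith)
  have h2 := h1.trans (hX.integral_le fun x => hB ((I x - h) / η))
  have hcomp : ContDiff ℝ 1 fun x => θ ((I x - h) / η) :=
    (contDiff_rescale hθ h η).comp hI.contDiff
  have hint := integrableOn_ball_of_continuous (hcomp.continuous_fderiv one_ne_zero).norm (R₁ + 1)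
  have h3 : c / η * volume.real (levelBand R₁ h η I)
      ≤ ∫ x in levelBand R₁ h η I, ‖fderiv ℝ (fun x => θ ((I x - h) / η)) x‖ := by
    refine setIntegral_ge_of_const_le_real (measurableSet_levelBand hI.contDiff.continuous η)
      (levelBand_ne_top η) (fun x hx => ?_) (hint.mono_set inter_subset_left)
    have hd := fderiv_comp_real (F := fun t => θ ((t - h) / η))
      ((contDiff_rescale hθ h η).differentiable one_ne_zero)
      (hI.contDiff.differentiable one_ne_zero) x
    have hx2 : |I x - h| ≤ η := hx.2
    have hu : 1 ≤ deriv θ ((I x - h) / η) := hθ1 _ (by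
      rw [abs_div, abs_of_pos hη]
      exact (div_le_one hη).2 hx2)
    have hg := hI.gradient_ge x (hx2.trans (by linarith))
    rw [hd, hder, norm_smul, Real.norm_of_nonneg (mul_nonneg (hθ0 _) (by positivity))]
    calc c / η = 1 * (1 / η) * c := by ring
      _ ≤ deriv θ ((I x - h) / η) * (1 / η) * ‖fderiv ℝ I x‖ := by gcongr
  have h4 := setIntegral_mono_set hint (Eventually.of_forall fun x => norm_nonneg _)
    (LE.le.eventuallyLE (inter_subset_left (s := Metric.ball (0 : Plane) (R₁ + 1))
      (t := {x | |I x - h| ≤ η})))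
  have h5 : c / η * volume.real (levelBand R₁ h η I) ≤ 2 * (B * C * V) := by
    have := h3.trans h4
    linarith
  calc volume.real (levelBand R₁ h η I)
      = (η / c) * (c / η * volume.real (levelBand R₁ h η I)) := by field_simp
    _ ≤ (η / c) * (2 * (B * C * V)) := by gcongr
    _ = 2 * (B * C * V) / c * η := by ring

/-- The sharp threshold of `I` at level `h`. -/
noncomputable def sharpThreshold (h : ℝ) (I : Plane → ℝ) : Plane → ℝ :=
  {x | h < I x}.indicator 1

theorem measurable_sharpThreshold (hI : Continuous I) : Measurable (sharpThreshold h I) :=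
  measurable_one.indicator (isOpen_lt continuous_const hI).measurableSet

theorem abs_sharpThreshold_le (x : Plane) : |sharpThreshold h I x| ≤ 1 := by
  unfold sharpThreshold
  by_cases hx : x ∈ {x | h < I x}
  · simp [indicator_of_mem hx]
  · simp [indicator_of_notMem hx]

theorem integrableOn_sharpThreshold (hI : Continuous I) (r : ℝ) :
    IntegrableOn (sharpThreshold h I) (Metric.ball 0 r) :=
  Measure.integrableOn_of_bounded (M := 1) measure_ball_lt_top.ne
    (measurable_sharpThreshold hI).aestronglyMeasurable
    (Eventually.of_forall fun x => abs_sharpThreshold_le x)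

theorem abs_smooth_sub_sharp_le (hφ_mono : Monotone φ)
    (hφ_zero : ∀ t, t ≤ -(1 / 2) → φ t = 0) (hφ_one : ∀ t, 1 / 2 ≤ t → φ t = 1) {η : ℝ}
    (hη : 0 < η) (x : Plane) :
    |φ ((I x - h) / η) - sharpThreshold h I x| ≤ {x | |I x - h| ≤ η}.indicator 1 x := by
  have h0 := profile_nonneg hφ_mono hφ_zero ((I x - h) / η)
  have h1 := profile_le_one hφ_mono hφ_one ((I x - h) / η)
  unfold sharpThreshold
  by_cases hx : |I x - h| ≤ η
  · rw [indicator_of_mem (show x ∈ {x | |I x - h| ≤ η} from hx), Pi.one_apply]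
    by_cases hs : x ∈ {x | h < I x}
    · rw [indicator_of_mem hs, Pi.one_apply, abs_le]
      constructor <;> linarith
    · rw [indicator_of_notMem hs, abs_le]
      constructor <;> linarith
  · rw [indicator_of_notMem (show x ∉ {x | |I x - h| ≤ η} from hx)]
    rcases lt_abs.1 (not_le.1 hx) with hl | hl
    · rw [indicator_of_mem (show x ∈ {x | h < I x} by simp only [mem_ofPred_eq]; linarith),
        hφ_one _ (by rw [le_div_iff₀ hη]; linarith)]
      simp
    · rw [indicator_of_notMem (show x ∉ {x | h < I x} by simp only [mem_ofPred_eq]; linarith),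
        hφ_zero _ (by rw [div_le_iff₀ hη]; linarith)]
      simp

theorem integral_abs_smooth_sub_sharp_le (hφ : ContDiff ℝ 1 φ) (hφ_mono : Monotone φ)
    (hφ_zero : ∀ t, t ≤ -(1 / 2) → φ t = 0) (hφ_one : ∀ t, 1 / 2 ≤ t → φ t = 1) {η : ℝ}
    (hη : 0 < η) (hI : ContDiff ℝ 1 I) :
    IntegrableOn (fun x => |φ ((I x - h) / η) - sharpThreshold h I x|)
      (Metric.ball 0 (R₁ + 1)) ∧
    ∫ x in Metric.ball (0 : Plane) (R₁ + 1), |φ ((I x - h) / η) - sharpThreshold h I x|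
      ≤ volume.real (levelBand R₁ h η I) := by
  have hΦ : Continuous fun x => φ ((I x - h) / η) :=
    ((contDiff_rescale hφ h η).comp hI).continuous
  have hint : IntegrableOn (fun x => |φ ((I x - h) / η) - sharpThreshold h I x|)
      (Metric.ball 0 (R₁ + 1)) :=
    ((integrableOn_ball_of_continuous hΦ _).sub (integrableOn_sharpThreshold hI.continuous _)).norm
  have hband : MeasurableSet {x | |I x - h| ≤ η} :=
    (isClosed_le (by have := hI.continuous; fun_prop) continuous_const).measurableSet
  refine ⟨hint, ?_⟩
  calc ∫ x in Metric.ball (0 : Plane) (R₁ + 1), |φ ((I x - h) / η) - sharpThreshold h I x|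
      ≤ ∫ x in Metric.ball (0 : Plane) (R₁ + 1), {x | |I x - h| ≤ η}.indicator 1 x := by
        refine integral_mono hint ?_ fun x =>
          abs_smooth_sub_sharp_le hφ_mono hφ_zero hφ_one hη x
        exact (integrableOn_const (C := (1 : ℝ)) measure_ball_lt_top.ne).indicator hband
    _ = volume.real (levelBand R₁ h η I) := by
        rw [integral_indicator_one hband, levelBand, inter_comm]
        simp [measureReal_def, Measure.restrict_apply hband]

theorem abs_integral_smooth_sub_sharp_le (hφ : ContDiff ℝ 1 φ) (hφ_mono : Monotone φ)
    (hφ_zero : ∀ t, t ≤ -(1 / 2) → φ t = 0) (hφ_one : ∀ t, 1 / 2 ≤ t → φ t = 1) {η C : ℝ}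
    (hη : 0 < η) (hI : ContDiff ℝ 1 I) {k : Plane → ℝ} (hk : Continuous k) (hkC : ∀ x, |k x| ≤ C) :
    |(∫ x in Metric.ball (0 : Plane) (R₁ + 1), φ ((I x - h) / η) * k x)
      - ∫ x in Metric.ball (0 : Plane) (R₁ + 1), sharpThreshold h I x * k x|
      ≤ C * volume.real (levelBand R₁ h η I) := by
  have hΦ : Continuous fun x => φ ((I x - h) / η) :=
    ((contDiff_rescale hφ h η).comp hI).continuous
  have i1 : IntegrableOn (fun x => φ ((I x - h) / η) * k x) (Metric.ball 0 (R₁ + 1)) :=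
    integrableOn_ball_of_continuous (hΦ.mul hk) (R₁ + 1)
  have i2 : IntegrableOn (fun x => sharpThreshold h I x * k x) (Metric.ball 0 (R₁ + 1)) :=
    (integrableOn_sharpThreshold hI.continuous _).mul_bdd (c := C) hk.aestronglyMeasurable
      (Eventually.of_forall hkC)
  obtain ⟨i3, h3⟩ := integral_abs_smooth_sub_sharp_le (R₁ := R₁) (h := h) hφ hφ_mono hφ_zero
    hφ_one hη hI
  have hC : 0 ≤ C := (abs_nonneg _).trans (hkC 0)
  rw [← integral_sub i1 i2, ← Real.norm_eq_abs]
  calc _ ≤ ∫ x in Metric.ball (0 : Plane) (R₁ + 1),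
        C * |φ ((I x - h) / η) - sharpThreshold h I x| := by
        refine norm_integral_le_of_norm_le (i3.const_mul C) (Eventually.of_forall fun x => ?_)
        rw [← sub_mul, norm_mul, mul_comm]
        exact mul_le_mul_of_nonneg_right (hkC x) (norm_nonneg _)
    _ ≤ _ := by
        rw [integral_const_mul]
        gcongr

end Levels

/-! ### Comparison of total variations and uniform strict convergence -/

section StrictConvergence

variable {α : ℝ≥0} {M R₁ h δ c : ℝ} {φ : ℝ → ℝ} {I : Plane → ℝ}

theorem le_of_forall_le_add_mul {a b k d : ℝ} (hd : 0 < d)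
    (H : ∀ s, 0 < s → s ≤ d → a ≤ b + k * s) : a ≤ b := by
  have h1 : Tendsto (fun s : ℝ => b + k * s) (𝓝[>] 0) (𝓝 b) := by
    have : ContinuousAt (fun s : ℝ => b + k * s) 0 := by fun_prop
    simpa using this.tendsto.mono_left (nhdsWithin_le_nhds (s := Ioi 0))
  refine ge_of_tendsto h1 ?_
  have h2 : ∀ᶠ s : ℝ in 𝓝[>] 0, s ≤ d := nhdsWithin_le_nhds (eventually_le_nhds hd)
  filter_upwards [eventually_mem_nhdsWithin, h2] with s hs hsd using H s hs hsd

/-- The smooth threshold of `I` at level `h` and width `η`. -/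
noncomputable def smoothThreshold (φ : ℝ → ℝ) (h η : ℝ) (I : Plane → ℝ) : Plane → ℝ :=
  fun x => φ ((I x - h) / η)

theorem contDiff_smoothThreshold (hφ : ContDiff ℝ 1 φ) (hI : ContDiff ℝ 1 I) (η : ℝ) :
    ContDiff ℝ 1 (smoothThreshold φ h η I) :=
  (contDiff_rescale hφ h η).comp hI

theorem totalVar_smoothThreshold_lt_top (hφ : ContDiff ℝ 1 φ) (hI : ContDiff ℝ 1 I) (η r : ℝ) :
    totalVar (Metric.ball 0 r) (smoothThreshold φ h η I) < ⊤ :=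
  (isBV_ball_of_contDiff (contDiff_smoothThreshold hφ hI η) r).2

theorem IsAligned.totalVar_smoothThreshold_le {ε C η : ℝ} {X : Plane → Plane}
    (hφ : ContDiff ℝ 1 φ) (hφ_mono : Monotone φ)
    (hφ_zero : ∀ t, t ≤ -(1 / 2) → φ t = 0) (hφ_one : ∀ t, 1 / 2 ≤ t → φ t = 1)
    (hX : IsAligned R₁ h δ ε C I X) (hε : ε ≤ 1) (hI : ContDiff ℝ 1 I) (hη : 0 < η)
    (hηδ : η ≤ δ) :
    (1 - ε) * (totalVar (Metric.ball 0 (R₁ + 1)) (smoothThreshold φ h η I)).toReal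
      ≤ ∫ x in Metric.ball (0 : Plane) (R₁ + 1), smoothThreshold φ h η I x * divergence X x := by
  have hφd := hφ.differentiable one_ne_zero
  have hder : ∀ t, deriv (fun t => φ ((t - h) / η)) t = deriv φ ((t - h) / η) * (1 / η) := fun t =>
    (hasDerivAt_rescale hφd h η t).deriv
  refine le_trans ?_ (hX.le_integral hI (contDiff_rescale hφ h η) (fun t => ?_) fun t ht => ?_)
  · refine mul_le_mul_of_nonneg_left ?_ (by linarith)
    exact ENNReal.toReal_le_of_le_ofReal (integral_nonneg fun x => norm_nonneg _)
      (totalVar_ball_le (contDiff_smoothThreshold hφ hI η) _)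
  · rw [hder]
    exact mul_nonneg hφ_mono.deriv_nonneg (by positivity)
  · rw [hder, deriv_profile_eq_zero hφd hφ_zero hφ_one, zero_mul]
    rw [abs_div, abs_of_pos hη, le_div_iff₀ hη]
    linarith

/-- Uniform bound for the total variations of the sharp and smooth thresholds. -/
theorem exists_totalVar_le (hφ : ContDiff ℝ 1 φ) (hφ_mono : Monotone φ)
    (hφ_zero : ∀ t, t ≤ -(1 / 2) → φ t = 0) (hφ_one : ∀ t, 1 / 2 ≤ t → φ t = 1)
    (hα0 : 0 < α) (hM : 0 ≤ M) (hR₁ : 0 < R₁) (hc : 0 < c) (h : ℝ) (hδ : 0 < δ) :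
    ∃ B, 0 ≤ B ∧ ∀ I, IsRegularNear α M R₁ h δ c I →
      totalVar (Metric.ball 0 (R₁ + 1)) (sharpThreshold h I) ≤ ENNReal.ofReal B ∧
      ∀ η, 0 < η → η ≤ δ / 2 →
        (totalVar (Metric.ball 0 (R₁ + 1)) (smoothThreshold φ h η I)).toReal ≤ B := by
  obtain ⟨C, hC, H⟩ := exists_isAligned (ε := 1 / 2) hα0 hM hR₁ hc h δ (by norm_num) (by norm_num)
  obtain ⟨m, hm, Hm⟩ := exists_volume_levelBand_le (α := α) hα0 hM hR₁ hc h δ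
  set V := volume.real (Metric.ball (0 : Plane) (R₁ + 1))
  have hV : 0 ≤ V := measureReal_nonneg
  refine ⟨2 * (1 * C * V), by positivity, fun I hI => ?_⟩
  obtain ⟨X, hX⟩ := H I hI
  have smooth : ∀ η, 0 < η → η ≤ δ / 2 →
      (totalVar (Metric.ball 0 (R₁ + 1)) (smoothThreshold φ h η I)).toReal ≤ 2 * (1 * C * V) := by
    intro η hη hηδ
    have h1 := hX.totalVar_smoothThreshold_le hφ hφ_mono hφ_zero hφ_one (by norm_num)
      hI.contDiff hη (by linarith)
    have h2 := hX.integral_le (g := smoothThreshold φ h η I) (B := 1) fun x => by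
      rw [smoothThreshold, abs_of_nonneg (profile_nonneg hφ_mono hφ_zero _)]
      exact profile_le_one hφ_mono hφ_one _
    linarith [h1.trans h2]
  refine ⟨totalVar_le fun Y hY => ?_, smooth⟩
  obtain ⟨CY, hCY, hYb⟩ := hY.exists_abs_divergence_le
  -- The divergence of `Y` has no uniform bound, but `Y` is fixed while the width tends to zero: the
  -- sharp threshold inherits the bound by lower semicontinuity.
  refine le_of_forall_le_add_mul (k := CY * m) (d := δ / 2) (by linarith) fun η hη hηδ => ?_
  have h1 := abs_integral_smooth_sub_sharp_le (R₁ := R₁) (h := h) hφ hφ_mono hφ_zero hφ_one hη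
    hI.contDiff hY.continuous_divergence hYb
  have h2 := hY.le_toReal_totalVar (totalVar_smoothThreshold_lt_top (h := h) hφ hI.contDiff η _)
  have h3 := mul_le_mul_of_nonneg_left (Hm I hI η hη hηδ) hCY
  have h4 := smooth η hη hηδ
  have h5 := (abs_le.1 h1).1
  simp only [smoothThreshold] at h2 h4
  linarith

/-- Uniform comparison of the total variations of the sharp and smooth thresholds. -/
theorem exists_totalVar_comparison (hφ : ContDiff ℝ 1 φ) (hφ_mono : Monotone φ)
    (hφ_zero : ∀ t, t ≤ -(1 / 2) → φ t = 0) (hφ_one : ∀ t, 1 / 2 ≤ t → φ t = 1)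
    (hα0 : 0 < α) (hM : 0 ≤ M) (hR₁ : 0 < R₁) (hc : 0 < c) (h : ℝ) (hδ : 0 < δ) {ε : ℝ}
    (hε0 : 0 < ε) (hε1 : ε ≤ 1) :
    ∃ C, 0 ≤ C ∧ ∀ I, IsRegularNear α M R₁ h δ c I → ∀ η, 0 < η → η ≤ δ / 2 →
      (1 - ε) * (totalVar (Metric.ball 0 (R₁ + 1)) (smoothThreshold φ h η I)).toReal
        ≤ (totalVar (Metric.ball 0 (R₁ + 1)) (sharpThreshold h I)).toReal + C * η ∧
      (1 - ε) * (totalVar (Metric.ball 0 (R₁ + 1)) (sharpThreshold h I)).toReal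
        ≤ (totalVar (Metric.ball 0 (R₁ + 1)) (smoothThreshold φ h η I)).toReal + C * η := by
  obtain ⟨C, hC, H⟩ := exists_isAligned (ε := ε) hα0 hM hR₁ hc h δ hε0 hε1
  obtain ⟨m, hm, Hm⟩ := exists_volume_levelBand_le (α := α) hα0 hM hR₁ hc h δ
  obtain ⟨B, hB, HB⟩ := exists_totalVar_le hφ hφ_mono hφ_zero hφ_one hα0 hM hR₁ hc h hδ
  refine ⟨C * m, by positivity, fun I hI η hη hηδ => ?_⟩
  obtain ⟨X, hX⟩ := H I hI
  have hfin : totalVar (Metric.ball 0 (R₁ + 1)) (sharpThreshold h I) < ⊤ :=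
    (HB I hI).1.trans_lt ENNReal.ofReal_lt_top
  set T := (totalVar (Metric.ball 0 (R₁ + 1)) (sharpThreshold h I)).toReal with hT
  have close : ∀ (Y : Plane → Plane) (CY : ℝ), IsTestField (Metric.ball 0 (R₁ + 1)) Y → 0 ≤ CY →
      (∀ x, |divergence Y x| ≤ CY) → ∀ s, 0 < s → s ≤ δ / 2 →
      |(∫ x in Metric.ball (0 : Plane) (R₁ + 1), smoothThreshold φ h s I x * divergence Y x)
        - ∫ x in Metric.ball (0 : Plane) (R₁ + 1), sharpThreshold h I x * divergence Y x|
        ≤ CY * m * s := fun Y CY hY hCY hYb s hs hsδ => by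
    refine (abs_integral_smooth_sub_sharp_le (R₁ := R₁) (h := h) hφ hφ_mono hφ_zero hφ_one hs
      hI.contDiff hY.continuous_divergence hYb).trans ?_
    rw [mul_assoc]
    exact mul_le_mul_of_nonneg_left (Hm I hI s hs hsδ) hCY
  -- Testing the sharp threshold with the single field `X` almost dominates the total variation of
  -- the smooth threshold at every small width `s`.
  have lower : ∀ s, 0 < s → s ≤ δ / 2 →
      (1 - ε) * (totalVar (Metric.ball 0 (R₁ + 1)) (smoothThreshold φ h s I)).toReal
        ≤ (∫ x in Metric.ball (0 : Plane) (R₁ + 1), sharpThreshold h I x * divergence X x)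
          + C * m * s := fun s hs hsδ => by
    have h1 := hX.totalVar_smoothThreshold_le hφ hφ_mono hφ_zero hφ_one hε1 hI.contDiff hs
      (by linarith)
    have h2 := (abs_le.1 (close X C hX.testField hC hX.div_le s hs hsδ)).2
    linarith
  constructor
  · have h1 := lower η hη hηδ
    have h2 := hX.testField.le_toReal_totalVar hfin
    linarith
  · set S := (totalVar (Metric.ball 0 (R₁ + 1)) (smoothThreshold φ h η I)).toReal with hS
    have hS0 : 0 ≤ S := ENNReal.toReal_nonneg
    have upper : (∫ x in Metric.ball (0 : Plane) (R₁ + 1), sharpThreshold h I x * divergence X x)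
        ≤ S + C * m * η := by
      have h1 := hX.testField.le_toReal_totalVar
        (totalVar_smoothThreshold_lt_top (h := h) hφ hI.contDiff η _)
      have h2 := (abs_le.1 (close X C hX.testField hC hX.div_le η hη hηδ)).1
      linarith
    rcases hε1.eq_or_lt with rfl | hlt
    · rw [sub_self, zero_mul]
      positivity
    have h1ε : 0 < 1 - ε := by linarith
    rw [mul_comm, ← le_div_iff₀ h1ε]
    refine ENNReal.toReal_le_of_le_ofReal (by positivity) (totalVar_le fun Y hY => ?_)
    rw [le_div_iff₀ h1ε, mul_comm]
    obtain ⟨CY, hCY, hYb⟩ := hY.exists_abs_divergence_le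
    -- For fixed `Y`, the sharp threshold is replaced by the smooth one of width `s`, whose
    -- variation is controlled by `lower` and then by `upper`, at the fixed width `η`. Letting `s →
    -- 0` removes the errors depending on `Y`.
    refine le_of_forall_le_add_mul (k := C * m + (1 - ε) * (CY * m)) (d := δ / 2) (by linarith)
      fun s hs hsδ => ?_
    have h1 := (abs_le.1 (close Y CY hY hCY hYb s hs hsδ)).1
    have h2 := hY.le_toReal_totalVar
      (totalVar_smoothThreshold_lt_top (h := h) hφ hI.contDiff s _)
    have h3 := lower s hs hsδ
    have h4 : (1 - ε) * (∫ x in Metric.ball (0 : Plane) (R₁ + 1),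
          sharpThreshold h I x * divergence Y x)
        ≤ (1 - ε) * ((totalVar (Metric.ball 0 (R₁ + 1)) (smoothThreshold φ h s I)).toReal
          + CY * m * s) :=
      mul_le_mul_of_nonneg_left (by linarith) h1ε.le
    linarith

/-- The strict-convergence distance between the smooth and the sharp threshold tends to zero,
uniformly over the functions that are regular near the level. -/
theorem exists_strictDist_le (hφ : ContDiff ℝ 1 φ) (hφ_mono : Monotone φ)
    (hφ_zero : ∀ t, t ≤ -(1 / 2) → φ t = 0) (hφ_one : ∀ t, 1 / 2 ≤ t → φ t = 1)
    (hα0 : 0 < α) (hM : 0 ≤ M) (hR₁ : 0 < R₁) (hc : 0 < c) (h : ℝ) (hδ : 0 < δ) {a : ℝ}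
    (ha : 0 < a) {e : ℝ} (he : 0 < e) :
    ∃ η₀, 0 < η₀ ∧ ∀ η, 0 < η → η ≤ η₀ → ∀ I, IsRegularNear α M R₁ h δ c I →
      strictDist a (Metric.ball 0 (R₁ + 1)) (smoothThreshold φ h η I) (sharpThreshold h I) ≤ e := by
  obtain ⟨m, hm, Hm⟩ := exists_volume_levelBand_le (α := α) hα0 hM hR₁ hc h δ
  obtain ⟨B, hB, HB⟩ := exists_totalVar_le hφ hφ_mono hφ_zero hφ_one hα0 hM hR₁ hc h hδ
  -- The comparison has a relative error `ε`. As the variations are at most `B`, this choice makes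
  -- it cost at most `e/2` in the distance; the choice of `η₀` handles the terms linear in `η`.
  set ε := min 1 (e / (2 * a * (B + 1))) with hε
  have hε0 : 0 < ε := by positivity
  have hεe : a * (ε * B) ≤ e / 2 := by
    calc a * (ε * B) ≤ a * (e / (2 * a * (B + 1)) * (B + 1)) := by
          gcongr
          · exact min_le_right _ _
          · linarith
      _ = e / 2 := by field_simp
  obtain ⟨C, hC, HC⟩ := exists_totalVar_comparison hφ hφ_mono hφ_zero hφ_one hα0 hM hR₁ hc h hδ
    hε0 (min_le_left _ _)
  refine ⟨min (δ / 2) (e / (2 * (m + a * C + 1))), by positivity, fun η hη hηle I hI => ?_⟩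
  have hηδ : η ≤ δ / 2 := hηle.trans (min_le_left _ _)
  have hηe : (m + a * C) * η ≤ e / 2 := by
    calc (m + a * C) * η ≤ (m + a * C + 1) * (e / (2 * (m + a * C + 1))) := by
          refine mul_le_mul (by linarith) (hηle.trans (min_le_right _ _)) hη.le (by positivity)
      _ = e / 2 := by field_simp
  obtain ⟨c1, c2⟩ := HC I hI η hη hηδ
  obtain ⟨b1, b2⟩ := HB I hI
  have b3 := ENNReal.toReal_le_of_le_ofReal hB b1
  have b4 := b2 η hη hηδ
  have h1 := (integral_abs_smooth_sub_sharp_le (R₁ := R₁) (h := h) hφ hφ_mono hφ_zero hφ_one hη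
    hI.contDiff).2.trans (Hm I hI η hη hηδ)
  have h2 : |(totalVar (Metric.ball 0 (R₁ + 1)) (smoothThreshold φ h η I)).toReal
      - (totalVar (Metric.ball 0 (R₁ + 1)) (sharpThreshold h I)).toReal| ≤ ε * B + C * η := by
    have k3 := mul_le_mul_of_nonneg_left b3 hε0.le
    have k4 := mul_le_mul_of_nonneg_left b4 hε0.le
    rw [abs_le]
    constructor <;> linarith
  have h3 := mul_le_mul_of_nonneg_left h2 ha.le
  unfold strictDist
  simp only [smoothThreshold] at h1 h3 ⊢
  linarith

end StrictConvergence

/-! ### The intensity is regular near the threshold -/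

/-- The gradient bound `√c` comes from `|∇𝓘|² > ψ(𝓘) ≥ c` near the level; the enclosure is the
hypothesis at the lowest level `h - δ`. -/
theorem isRegularNear_intensity {α : ℝ≥0} {K : Plane → ℂ} {Jhat : Plane → ℝ} {M R R₁ h δ c : ℝ}
    (hα0 : 0 < α) (hα1 : α ≤ 1) (hK : IsC1aLoc α K) (hJ : Integrable Jhat)
    {f : ℝ → ℝ≥0∞} (hf_anti : Antitone f)
    (hf_lim : 0 < liminf (fun s : ℝ => f s * ENNReal.ofReal (s ^ (2 / (α : ℝ)))) (𝓝[>] 0))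
    {ψ : ℝ → ℝ} (hψ : ContDiff ℝ 1 ψ) (hψδ : ∀ t ∈ Icc (h - δ) (h + δ), c ≤ ψ t)
    {u : Plane →₁[volume] ℝ} (hu : u ∈ masks R) (hfin : regTerm K Jhat f ψ u < ⊤)
    (hM : C1aBound α M (Metric.ball 0 (R₁ + 2)) (intensity K Jhat u))
    (hR₁ : exposed K Jhat (h - δ) u ⊆ Metric.ball 0 R₁) :
    IsRegularNear α M R₁ h δ (√c) (intensity K Jhat u) where
  contDiff := contDiff_intensity hα0 hα1 hK hJ hu
  bound := hM
  enclosed x hx := hR₁ hx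
  gradient_ge x hx := by
    have h1 := lt_sq_norm_fderiv hα0 hα1 hf_anti hf_lim hψ
      (differentiable_intensity hK.contDiff hJ hu)
      (fun r => (hK.exists_C1aBound_intensity hα1 hJ r).imp fun _ h => ⟨h.1, h.2 u hu⟩) hfin x
    have h2 := hψδ (intensity K Jhat u x) (by
      rw [abs_le] at hx
      constructor <;> linarith)
    exact Real.sqrt_le_iff.2 ⟨norm_nonneg _, h2.trans h1.le⟩

end Photolith

theorem proposition3p4
    (α : ℝ≥0) (hα0 : 0 < α) (hα1 : α ≤ 1)
    -- the point spread function and the mutual intensity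
    (K : Plane → ℂ) (hK : IsC1aLoc α K) (hK0 : Tendsto K (cocompact Plane) (𝓝 0))
    (Jhat : Plane → ℝ) (hJ : Integrable Jhat) (hJ0 : ∀ᵐ k, 0 ≤ Jhat k)
    -- radius containing the masks, threshold, weight of the distance
    (R h a : ℝ) (hR : 0 < R) (hh : 0 < h) (ha : 0 < a)
    -- the functions entering the regularization term
    (δ₀ : ℝ) (hδ₀ : 0 < δ₀)
    (f : ℝ → ℝ≥0∞) (hf : Continuous f) (hf_top : ∀ s, s ≤ 0 → f s = ⊤) (hf_anti : Antitone f)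
    (hf_zero : ∀ s, δ₀ ≤ s → f s = 0)
    (hf_lim : 0 < liminf (fun s : ℝ => f s * ENNReal.ofReal (s ^ (2 / (α : ℝ)))) (𝓝[>] 0))
    (ψ : ℝ → ℝ) (hψ : ContDiff ℝ 1 ψ) (hψ_pos : 0 < ψ h) (hψ_mono : MonotoneOn ψ (Iic h))
    (hψ_anti : AntitoneOn ψ (Ici h)) (hψ_zero : ψ 0 < -δ₀)
    (δ c₁ : ℝ) (hδ : 0 < δ) (hc₁ : 0 < c₁) (hψδ : ∀ t ∈ Icc (h - δ) (h + δ), c₁ ≤ ψ t)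
    (hψδ₀ : ψ 0 ≤ -(δ₀ + δ))
    -- the smooth threshold profile
    (φ : ℝ → ℝ) (hφ : ContDiff ℝ ∞ φ) (hφ_mono : Monotone φ)
    (hφ_zero : ∀ t, t ≤ -(1 / 2) → φ t = 0) (hφ_one : ∀ t, 1 / 2 ≤ t → φ t = 1) :
    -- there are radii enclosing all the level sets near the threshold
    (∃ R₁ : ℝ, R ≤ R₁ ∧ ∀ u ∈ masks R, regTerm K Jhat f ψ u < ⊤ →
      ∀ t ∈ Icc (h - δ) (h + δ), exposed K Jhat t u ⊆ Metric.ball 0 R₁) ∧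
    -- and for each such radius, on the ball of radius `R₁ + 1`:
    ∀ R₁ : ℝ, R ≤ R₁ →
      (∀ u ∈ masks R, regTerm K Jhat f ψ u < ⊤ →
        ∀ t ∈ Icc (h - δ) (h + δ), exposed K Jhat t u ⊆ Metric.ball 0 R₁) →
      -- every `Φ_η` maps into `C^{1,α}` and is uniformly continuous
      (∀ η : ℝ, 0 < η →
        (∀ u ∈ masks R, IsC1aLoc α (smoothMap K Jhat h φ η u)) ∧
        (IsC1a α univ K → ∀ u ∈ masks R, IsC1a α univ (smoothMap K Jhat h φ η u)) ∧
        ∀ ε : ℝ≥0∞, 0 < ε → ∃ ρ : ℝ, 0 < ρ ∧ ∀ u ∈ masks R, ∀ v ∈ masks R, ‖u - v‖ ≤ ρ →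
          c1aNorm α (Metric.ball 0 (R₁ + 1))
            (fun x => smoothMap K Jhat h φ η u x - smoothMap K Jhat h φ η v x) ≤ ε) ∧
      -- `Φ_η` converges to `𝓦` uniformly on the sublevel sets of the regularization term
      (∀ C : ℝ, 0 < C →
        (∀ u ∈ masks R, regTerm K Jhat f ψ u ≤ ENNReal.ofReal C →
          IsBV (Metric.ball 0 (R₁ + 1)) (sharpMap K Jhat h u) ∧
          ∀ η : ℝ, 0 < η → IsBV (Metric.ball 0 (R₁ + 1)) (smoothMap K Jhat h φ η u)) ∧
        ∀ ε : ℝ, 0 < ε → ∃ η₀ : ℝ, 0 < η₀ ∧ ∀ η : ℝ, 0 < η → η ≤ η₀ →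
          ∀ u ∈ masks R, regTerm K Jhat f ψ u ≤ ENNReal.ofReal C →
            strictDist a (Metric.ball 0 (R₁ + 1)) (smoothMap K Jhat h φ η u)
              (sharpMap K Jhat h u) ≤ ε) := by
  -- Otherwise `0` would lie in `[h - δ, h + δ]`, where `ψ ≥ c₁ > 0`, against `ψ 0 < 0`. Decay of
  -- the intensity encloses only the level sets of positive level.
  have hhδ : 0 < h - δ := by
    by_contra hle
    have h0 := hψδ 0 ⟨by linarith, by linarith⟩
    linarith
  refine ⟨?_, fun R₁ hR₁ hball => ⟨fun η hη => ⟨fun u hu r => ?_, fun hKg u hu => ?_,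
    fun ε hε => ?_⟩, fun C _ => ?_⟩⟩
  · obtain ⟨R₁, h1, h2⟩ := exists_exposed_subset_ball hK0 hJ hhδ R
    exact ⟨R₁, h1, fun u hu _ t ht => h2 u hu t ht.1⟩
  · obtain ⟨M, hM, hI⟩ := hK.exists_C1aBound_intensity (R := R) hα1 hJ r
    exact isC1a_smoothMap hα0 hα1 hK hJ hφ hφ_mono hφ_zero hφ_one h hη hu (convex_ball _ _) hM
      (hI u hu)
  · obtain ⟨M, hM, hb⟩ := exists_C1aBound_of_c1aNorm_lt_top hKg.2
    obtain ⟨M', hM', hI⟩ := exists_C1aBound_intensity (R := R) hα1 convex_univ hM hK.contDiff hb hJ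
      fun _ _ _ _ => mem_univ _
    exact isC1a_smoothMap hα0 hα1 hK hJ hφ hφ_mono hφ_zero hφ_one h hη hu convex_univ hM' (hI u hu)
  · obtain ⟨C, hC, hb⟩ := exists_c1aNorm_smoothMap_sub_le hα1 hK hJ hφ hφ_mono hφ_zero hφ_one h R
      (R₁ + 1) hη
    obtain ⟨e, he, heε⟩ := ENNReal.lt_iff_exists_nnreal_btwn.1 hε
    have he0 : (0 : ℝ) < e := by exact_mod_cast he
    -- The denominator `C + 1` covers the case `C = 0`.
    refine ⟨e / (C + 1), by positivity, fun u hu v hv huv => ?_⟩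
    refine (hb u hu v hv).trans (le_trans ?_ heε.le)
    rw [ENNReal.ofReal_le_coe]
    · calc C * ‖u - v‖ ≤ (C + 1) * (e / (C + 1)) :=
            mul_le_mul (by linarith) huv (norm_nonneg _) (by positivity)
        _ = e := by field_simp
  · have hR₁0 : 0 < R₁ := hR.trans_le hR₁
    have hφ1 : ContDiff ℝ 1 φ := hφ.of_le (by simp)
    -- One unit beyond the domain of radius `R₁ + 1` leaves room for the difference quotients.
    obtain ⟨M, hM, hI⟩ := hK.exists_C1aBound_intensity (R := R) hα1 hJ (R₁ + 2)
    have hreg : ∀ u ∈ masks R, regTerm K Jhat f ψ u ≤ ENNReal.ofReal C →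
        IsRegularNear α M R₁ h δ (√c₁) (intensity K Jhat u) := fun u hu huC =>
      have hfin := huC.trans_lt ENNReal.ofReal_lt_top
      isRegularNear_intensity hα0 hα1 hK hJ hf_anti hf_lim hψ hψδ hu hfin (hI u hu)
        (hball u hu hfin (h - δ) ⟨le_rfl, by linarith⟩)
    have hc : 0 < √c₁ := Real.sqrt_pos.2 hc₁
    refine ⟨fun u hu huC => ⟨⟨?_, ?_⟩, fun η _ => ?_⟩, fun ε hε => ?_⟩
    · exact integrableOn_sharpThreshold (hreg u hu huC).contDiff.continuous _
    · obtain ⟨B, -, HB⟩ := exists_totalVar_le hφ1 hφ_mono hφ_zero hφ_one hα0 hM hR₁0 hc h hδ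
      exact (HB _ (hreg u hu huC)).1.trans_lt ENNReal.ofReal_lt_top
    · exact isBV_ball_of_contDiff (contDiff_smoothMap hα0 hα1 hK hJ hφ h η hu) _
    · obtain ⟨η₀, hη₀, H⟩ := exists_strictDist_le hφ1 hφ_mono hφ_zero hφ_one hα0 hM hR₁0 hc h hδ
        ha hε
      exact ⟨η₀, hη₀, fun η hη hηle u hu huC => H η hη hηle _ (hreg u hu huC)⟩
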